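/- Let $V=(V,Y,\mathbf 1,\omega)$ be a vertex operator algebra over $\mathbb C$ ($\mathbb Z$-graded by the eigenvalues of $L(0)$, with finite-dimensional weight spaces $V_n$ that vanish for $n\ll 0$), with $Y(a,z)=\sum_n a(n)z^{-n-1}$. Let $M^1,M^2$ be admissible ($\mathbb N$-graded) $V$-modules, for instance ordinary ones, and let $M^3$ be an ordinary $V$-module, i.e. an admissible module such that each $M^3(n)$ is a finite-dimensional eigenspace of $L(0)$ of eigenvalue $h+n$, for some $h\in\mathbb C$. **Lie algebras.** The Borcherds Lie algebra is $L(V)=(V\otimes\mathbb C[t^{\pm1}])/\operatorname{Im}(L(-1)\otimes 1+1\otimes \tfrac{d}{dt})$, with $a_{[n]}$ the class of $a\otimes t^n$ and $[a_{[m]},b_{[n]}]=\sum_{j\ge 0}\binom mj (a(j)b)_{[m+n-j]}$; its degree-zero subalgebra is $L(V)_0=\mathrm{span}\{a_{[\mathrm{wt}\,a-1]}\}$. (Here and below, whenever $\mathrm{wt}\,a$ occurs, $a$ runs through the homogeneous elements of $V$.) The chiral Lie algebra of $(\mathbb P^1,\infty,1,0)$ is $\mathcal L=(V\otimes\mathbb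 C[z^{\pm1},(z-1)^{\pm1}])/\operatorname{Im}(L(-1)\otimes1+1\otimes\tfrac{d}{dz})$ with $[a\otimes f,b\otimes g]=\sum_{j\ge0}a(j)b\otimes\frac1{j!}\frac{d^jf}{dz^j}\,g$. Put $$\mathcal L_{\le0}=\mathrm{span}\Big\{a\otimes\tfrac{z^n}{(z-1)^m}: m,n\in\mathbb Z,\ n-m\le \mathrm{wt}\,a-1\Big\},\qquad \mathcal L_{<0}=\mathrm{span}\Big\{a\otimes\tfrac{z^n}{(z-1)^m}: m,n\in\mathbb Z,\ n-m<\mathrm{wt}\,a-1\Big\};$$ $\mathcal L_{\le 0}$ is a Lie subalgebra of $\mathcal L$, and $\mathcal L_{<0}$ is an ideal of $\mathcal L_{\le 0}$. **Actions.** $\mathcal L$ acts on $M^1$ (attached to $1$) by $\rho_1(a\otimes f)=\mathrm{Res}_{z=1}Y_{M^1}(a,z-1)f$, on $M^2$ (attached to $0$) by $\rho_0(a\otimes f)=\mathrm{Res}_{z=0}Y_{M^2}(a,z)f$, on $M^1\otimes M^2$ by $\rho_{1,0}(X)=\rho_1(X)\otimes 1+1\otimes\rho_0(X)$, and on the contragredient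 module $(M^3)'=\bigoplus_n M^3(n)^*$ (attached to $\infty$) by $\rho_\infty(a\otimes f)=-\sum_{s}f_s\,a'(s)$, where $f=\sum_s f_sz^s$ is the expansion of $f$ at $z=\infty$ in powers of $z^{-1}$ and $a'(s)=\sum_{j\ge0}\frac{(-1)^{\mathrm{wt}\,a}}{j!}(L(1)^ja)(2\,\mathrm{wt}\,a-s-j-2)$, the modes on the right being those of $Y_{(M^3)'}$. The subalgebra $\mathcal L_{\le0}$ preserves the bottom level $M^3(0)^*$ of $(M^3)'$, so it acts on $M^3(0)^*\otimes M^1\otimes M^2$ by the tensor product action. The space of $\infty$-restricted conformal blocks is $$\mathscr C(M^3(0)^*,M^1,M^2)=\left(\frac{M^3(0)^*\otimes M^1\otimes M^2}{\mathcal L_{\le0}.(M^3(0)^*\otimes M^1\otimes M^2)}\right)^*,$$ and the contracted tensor product is $M^1\odot M^2=(M^1\otimes M^2)/\mathcal L_{<0}.(M^1\otimes M^2)$, with $v_1\odot v_2$ the class of $v_1\otimes v_2$. **Statement.** 1. The map $a_{[\mathrm{wt}\,a-1]}\mapsto a\otimes z^{\mathrm{wt}\,a-1}+\mathcal L_{<0}$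 is a well-defined isomorphism of Lie algebras $L(V)_0\to\mathcal L_{\le0}/\mathcal L_{<0}$. Through it, $L(V)_0$ acts on $M^1\odot M^2$, where $a_{[\mathrm{wt}\,a-1]}$ acts as the operator induced by $\rho_{1,0}(a\otimes z^{\mathrm{wt}\,a-1})$. Moreover $L(V)_0$ acts on $M^3(0)$, where $a_{[\mathrm{wt}\,a-1]}$ acts as $o(a)=a(\mathrm{wt}\,a-1)$. 2. There is an isomorphism of vector spaces $$\Phi:\ \mathscr C(M^3(0)^*,M^1,M^2)\ \xrightarrow{\ \sim\ }\ \mathrm{Hom}_{L(V)_0}\big(M^1\odot M^2,\,M^3(0)\big)$$ such that $\langle v',\Phi(\varphi)(v_1\odot v_2)\rangle=\varphi(v'\otimes v_1\otimes v_2)$ for all $\varphi$, $v'\in M^3(0)^*$, $v_1\in M^1$ and $v_2\in M^2$. -/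

import Mathlib

open scoped TensorProduct Polynomial

noncomputable section

namespace ConformalBlocks

/-! ### Rings of functions on punctured affine lines -/

/-- The ring `ℂ[z][1/q]` of functions on the affine line that are regular away from the zeros
of `q`. -/
abbrev LocPoly (q : ℂ[X]) : Type := Localization.Away q

/-- The coordinate function `z`. -/
def coord (q : ℂ[X]) : LocPoly q := algebraMap ℂ[X] (LocPoly q) Polynomial.X

/-- Substitution of `x` for `z`, where `x` is an element of a `ℂ`-algebra in which `q(x)` is
invertible. -/
def evalAt (q : ℂ[X]) {S : Type*} [CommRing S] [Algebra ℂ S] (x : S)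
    (hx : IsUnit (Polynomial.aeval x q)) : LocPoly q →ₐ[ℂ] S :=
  IsLocalization.liftAlgHom (M := Submonoid.powers q) (f := Polynomial.aeval x) (by
    rintro ⟨_, n, rfl⟩
    simpa using hx.pow n)

theorem evalAt_algebraMap (q : ℂ[X]) {S : Type*} [CommRing S] [Algebra ℂ S] (x : S)
    (hx : IsUnit (Polynomial.aeval x q)) (p : ℂ[X]) :
    evalAt q x hx (algebraMap ℂ[X] (LocPoly q) p) = Polynomial.aeval x p := by
  simp [evalAt]

theorem evalAt_coord (q : ℂ[X]) {S : Type*} [CommRing S] [Algebra ℂ S] (x : S)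
    (hx : IsUnit (Polynomial.aeval x q)) : evalAt q x hx (coord q) = x := by
  rw [coord, evalAt_algebraMap, Polynomial.aeval_X]

theorem locPoly_algHom_ext (q : ℂ[X]) {S : Type*} [CommRing S] [Algebra ℂ S]
    {f g : LocPoly q →ₐ[ℂ] S} (h : f (coord q) = g (coord q)) : f = g := by
  have h1 : (f : LocPoly q →+* S) = (g : LocPoly q →+* S) := by
    refine IsLocalization.ringHom_ext (Submonoid.powers q) ?_
    have : (f.comp (IsScalarTower.toAlgHom ℂ ℂ[X] (LocPoly q))) =
        (g.comp (IsScalarTower.toAlgHom ℂ ℂ[X] (LocPoly q))) := by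
      ext
      simpa [coord] using h
    exact congrArg (fun k : ℂ[X] →ₐ[ℂ] S => (k : ℂ[X] →+* S)) this
  exact AlgHom.ext fun x => congrArg (fun k => k x) h1

/-- The homomorphism `f(z) ↦ f(z + ε) = f(z) + ε f'(z)` to the dual numbers. -/
def dualExpand (q : ℂ[X]) : LocPoly q →ₐ[ℂ] TrivSqZeroExt (LocPoly q) (LocPoly q) :=
  evalAt q (TrivSqZeroExt.inl (coord q) + TrivSqZeroExt.inr 1) (by
    rw [TrivSqZeroExt.isUnit_iff_isUnit_fst]
    have h : (TrivSqZeroExt.fstHom ℂ (LocPoly q) (LocPoly q)).comp (Polynomial.aeval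
        (TrivSqZeroExt.inl (coord q) + TrivSqZeroExt.inr 1)) =
        IsScalarTower.toAlgHom ℂ ℂ[X] (LocPoly q) := by
      ext
      simp [coord]
    have h2 := congrArg (fun k => k q) h
    simp only [AlgHom.comp_apply, TrivSqZeroExt.fstHom_apply, IsScalarTower.toAlgHom_apply] at h2
    rw [h2]
    exact IsLocalization.Away.algebraMap_isUnit q)

theorem fst_dualExpand (q : ℂ[X]) (f : LocPoly q) : (dualExpand q f).fst = f := by
  have h : (TrivSqZeroExt.fstHom ℂ (LocPoly q) (LocPoly q)).comp (dualExpand q) =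
      AlgHom.id ℂ _ := by
    apply locPoly_algHom_ext
    simp [dualExpand, evalAt_coord]
  exact congrArg (fun k => k f) h

/-- The derivation `d/dz`. -/
def ddz (q : ℂ[X]) : Derivation ℂ (LocPoly q) (LocPoly q) :=
  Derivation.mk' ((TrivSqZeroExt.sndHom (LocPoly q) (LocPoly q)).restrictScalars ℂ ∘ₗ
    (dualExpand q).toLinearMap) (by
    intro a b
    simp [fst_dualExpand, mul_comm])

theorem ddz_coord (q : ℂ[X]) : ddz q (coord q) = 1 := by
  simp [ddz, dualExpand, evalAt_coord]

/-- Two operators that satisfy the Leibniz rule over a homomorphism agree as soon as they agree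
on constants and on `z`. -/
theorem eq_of_leibniz (q : ℂ[X]) {K : Type*} [CommRing K] [Algebra ℂ K] (e : LocPoly q →ₐ[ℂ] K)
    (d₁ d₂ : LocPoly q →+ K)
    (h₁ : ∀ f g, d₁ (f * g) = e f * d₁ g + e g * d₁ f)
    (h₂ : ∀ f g, d₂ (f * g) = e f * d₂ g + e g * d₂ f)
    (c₁ : ∀ c : ℂ, d₁ (algebraMap ℂ _ c) = 0) (c₂ : ∀ c : ℂ, d₂ (algebraMap ℂ _ c) = 0)
    (h : d₁ (coord q) = d₂ (coord q)) : d₁ = d₂ := by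
  have key : ∀ p : ℂ[X], d₁ (algebraMap _ _ p) = d₂ (algebraMap _ _ p) := by
    intro p
    induction p using Polynomial.induction_on with
    | C a =>
      have : algebraMap ℂ[X] (LocPoly q) (Polynomial.C a) = algebraMap ℂ _ a := by
        rw [IsScalarTower.algebraMap_apply ℂ ℂ[X] (LocPoly q)]
        rfl
      rw [this, c₁, c₂]
    | add p r hp hr => simp [hp, hr]
    | monomial n a ih =>
      have hX : d₁ (algebraMap _ _ Polynomial.X) = d₂ (algebraMap _ _ Polynomial.X) := h
      rw [pow_succ, ← mul_assoc, map_mul, h₁, h₂, ih, hX]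
  ext f
  obtain ⟨p, ⟨b, hb⟩, rfl⟩ := IsLocalization.exists_mk'_eq (Submonoid.powers q) f
  have hspec := IsLocalization.mk'_spec (LocPoly q) p ⟨b, hb⟩
  set f := IsLocalization.mk' (LocPoly q) p ⟨b, hb⟩
  have e1 := h₁ f (algebraMap _ _ b)
  have e2 := h₂ f (algebraMap _ _ b)
  rw [hspec, key] at e1
  rw [hspec] at e2
  rw [key] at e1
  have hu : IsUnit (e (algebraMap _ _ b)) :=
    (IsLocalization.map_units (LocPoly q) (⟨b, hb⟩ : Submonoid.powers q)).map e
  have := e1.symm.trans e2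
  exact hu.mul_left_cancel (add_left_cancel this)

/-! ### Laurent expansions -/

theorem laurent_bddBelow {R : Type*} [CommRing R] (f : LaurentSeries R) :
    ∃ N : ℤ, ∀ n < N, f.coeff n = 0 :=
  ⟨f.order, fun _ hn => HahnSeries.coeff_eq_zero_of_lt_order hn⟩

theorem laurent_coeff_mul {R : Type*} [CommRing R] (f g : LaurentSeries R) (n : ℤ) :
    (f * g).coeff n = ∑ᶠ p : ℤ, f.coeff p * g.coeff (n - p) := by
  rw [HahnSeries.coeff_mul]
  have : Function.support (fun p : ℤ => f.coeff p * g.coeff (n - p)) ⊆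
      ↑((Finset.antidiagonal f.isPWO_support g.isPWO_support n).image Prod.fst) := by
    intro p hp
    have hp' : f.coeff p * g.coeff (n - p) ≠ 0 := hp
    simp only [Finset.coe_image, Set.mem_image, Finset.mem_coe]
    refine ⟨(p, n - p), ?_, rfl⟩
    simp only [Finset.mem_antidiagonal, HahnSeries.mem_support]
    exact ⟨left_ne_zero_of_mul hp', right_ne_zero_of_mul hp', by ring⟩
  rw [finsum_eq_sum_of_support_subset _ this, Finset.sum_image]
  · refine Finset.sum_congr rfl ?_
    rintro ⟨i, j⟩ hij
    simp only [Finset.mem_antidiagonal] at hij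
    obtain ⟨-, -, h⟩ := hij
    rw [← h]
    simp
  · rintro ⟨i, j⟩ hij ⟨i', j'⟩ hij' h
    simp only [Finset.mem_coe, Finset.mem_antidiagonal] at hij hij' h
    obtain ⟨-, -, h1⟩ := hij
    obtain ⟨-, -, h2⟩ := hij'
    ext
    · exact h
    · simp only at h h1 h2 ⊢
      lia

theorem laurent_derivative_coeff (f : LaurentSeries ℂ) (n : ℤ) :
    (LaurentSeries.derivative ℂ f).coeff n = ((n : ℂ) + 1) * f.coeff (n + 1) := by
  rw [LaurentSeries.derivative_apply, LaurentSeries.hasseDeriv_coeff]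
  simp

theorem finsum_finite_of_bdd {M : Type*} [AddCommMonoid M] (φ : ℤ → M) (a b : ℤ)
    (h : ∀ n, n < a ∨ b ≤ n → φ n = 0) : Function.HasFiniteSupport φ := by
  refine (Set.finite_Ico a b).subset ?_
  intro n hn
  by_contra hc
  apply hn
  apply h
  simp only [Set.mem_Ico, not_and_or, not_le, not_lt] at hc
  exact hc

theorem laurent_derivative_mul (f g : LaurentSeries ℂ) :
    LaurentSeries.derivative ℂ (f * g) =
      f * LaurentSeries.derivative ℂ g + g * LaurentSeries.derivative ℂ f := by
  obtain ⟨A, hA⟩ := laurent_bddBelow f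
  obtain ⟨B, hB⟩ := laurent_bddBelow g
  ext n
  rw [HahnSeries.coeff_add, mul_comm g, laurent_derivative_coeff, laurent_coeff_mul,
    laurent_coeff_mul, laurent_coeff_mul]
  simp only [laurent_derivative_coeff]
  rw [← finsum_comp_equiv (Equiv.subRight (1 : ℤ))
    (f := fun p : ℤ => ((p : ℂ) + 1) * f.coeff (p + 1) * g.coeff (n - p)),
    ← finsum_add_distrib, ← smul_eq_mul, smul_finsum]
  · refine finsum_congr fun p => ?_
    simp only [Equiv.subRight_apply, sub_add_cancel, smul_eq_mul]
    have e1 : n - p + 1 = n + 1 - p := by ring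
    have e2 : n - (p - 1) = n + 1 - p := by ring
    rw [e1, e2]
    push_cast
    ring
  · refine finsum_finite_of_bdd _ A (n + 2 - B) ?_
    rintro p (hp | hp)
    · simp [hA p hp]
    · simp [hB (n - p + 1) (by lia)]
  · refine finsum_finite_of_bdd _ A (n + 2 - B) ?_
    rintro p (hp | hp)
    · simp [hA p hp]
    · have : g.coeff (n - (p - 1)) = 0 := hB _ (by lia)
      simp [this]

theorem evalAt_ddz (q : ℂ[X]) (x : LaurentSeries ℂ) (hx : IsUnit (Polynomial.aeval x q))
    (w : LaurentSeries ℂ) (hw : w * LaurentSeries.derivative ℂ x = 1) (f : LocPoly q) :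
    evalAt q x hx (ddz q f) = w * LaurentSeries.derivative ℂ (evalAt q x hx f) := by
  have := eq_of_leibniz q (evalAt q x hx)
    ((evalAt q x hx : LocPoly q →+ LaurentSeries ℂ).comp (ddz q : LocPoly q →+ LocPoly q))
    ((AddMonoidHom.mulLeft w).comp ((LaurentSeries.derivative ℂ).toAddMonoidHom.comp
      (evalAt q x hx : LocPoly q →+ LaurentSeries ℂ)))
    (by intro f g; simp)
    (by
      intro f g
      simp only [AddMonoidHom.comp_apply, AddMonoidHom.coe_mulLeft, LinearMap.toAddMonoidHom_coe,
        AddMonoidHom.coe_coe, map_mul, laurent_derivative_mul]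
      ring)
    (by intro c; simp)
    (by
      intro c
      have : algebraMap ℂ (LaurentSeries ℂ) c = HahnSeries.C c := by
        rw [HahnSeries.algebraMap_apply', PowerSeries.algebraMap_eq]
        simp
      simp only [AddMonoidHom.comp_apply, AddMonoidHom.coe_mulLeft, LinearMap.toAddMonoidHom_coe,
        AddMonoidHom.coe_coe, AlgHom.commutes, this]
      simp [HahnSeries.C_apply, LaurentSeries.derivative_apply])
    (by simp [ddz_coord, evalAt_coord, ← hw])
  exact congrArg (fun k => k f) this

/-- `ℂ[z, z⁻¹]` -/
abbrev LaurentRing : Type := LocPoly Polynomial.X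

/-- `ℂ[z, z⁻¹, (z - 1)⁻¹]` -/
abbrev ChiralRing : Type := LocPoly (Polynomial.X * (Polynomial.X - 1))

/-- The unit `z` of `ℂ[z, z⁻¹]`. -/
def laurentZ : LaurentRingˣ :=
  (IsLocalization.Away.algebraMap_isUnit (S := LaurentRing) (Polynomial.X : ℂ[X])).unit

theorem isUnit_coord_mul : IsUnit (coord _ * (coord _ - 1) : ChiralRing) := by
  have := IsLocalization.Away.algebraMap_isUnit (S := ChiralRing)
      (Polynomial.X * (Polynomial.X - 1) : ℂ[X])
  rwa [map_mul, map_sub, map_one] at this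

/-- The unit `z` of `ℂ[z, z⁻¹, (z - 1)⁻¹]`. -/
def chiralZ : ChiralRingˣ :=
  (isUnit_of_mul_isUnit_left (y := coord _ - 1) isUnit_coord_mul : IsUnit (coord _ : ChiralRing)).unit

/-- The unit `z - 1` of `ℂ[z, z⁻¹, (z - 1)⁻¹]`. -/
def chiralZ1 : ChiralRingˣ :=
  (isUnit_of_mul_isUnit_right (x := coord _) isUnit_coord_mul : IsUnit (coord _ - 1 : ChiralRing)).unit

/-- `zⁿ` in `ℂ[z, z⁻¹]` -/
def laurentFn (n : ℤ) : LaurentRing := ((laurentZ ^ n : LaurentRingˣ) : LaurentRing)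

/-- `zⁿ / (z - 1)ᵐ` in `ℂ[z, z⁻¹, (z - 1)⁻¹]` -/
def chiralFn (n m : ℤ) : ChiralRing :=
  ((chiralZ ^ n * chiralZ1 ^ (-m) : ChiralRingˣ) : ChiralRing)

theorem derivation_unit_zpow {R : Type*} [CommRing R] [Algebra ℂ R] (D : Derivation ℂ R R)
    (u : Rˣ) (n : ℤ) : D ((u ^ n : Rˣ) : R) = (n : ℂ) • (((u ^ (n - 1) : Rˣ) : R) * D u) := by
  have hnat : ∀ k : ℕ, D ((u ^ (k : ℤ) : Rˣ) : R) =
      ((k : ℤ) : ℂ) • (((u ^ ((k : ℤ) - 1) : Rˣ) : R) * D u) := by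
    intro k
    induction k with
    | zero => simp
    | succ k ih =>
      push_cast
      have e : (u : R) * ((u ^ ((k : ℤ) - 1) : Rˣ) : R) = ((u ^ (k : ℤ) : Rˣ) : R) := by
        rw [mul_comm, ← Units.val_mul, ← zpow_add_one, sub_add_cancel]
      rw [zpow_add, zpow_one, Units.val_mul, D.leibniz, ih, add_sub_cancel_right,
        smul_eq_mul, smul_eq_mul, mul_smul_comm, ← mul_assoc, e, add_smul, one_smul, add_comm]
      simp
  obtain ⟨k, rfl | rfl⟩ := n.eq_nat_or_neg
  · exact hnat k
  · have h0 : ((u ^ (-(k : ℤ)) : Rˣ) : R) * ((u ^ (k : ℤ) : Rˣ) : R) = 1 := by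
      rw [← Units.val_mul, ← zpow_add]
      simp
    have e : ((u ^ (-(k : ℤ)) : Rˣ) : R) ^ 2 * ((u ^ ((k : ℤ) - 1) : Rˣ) : R) =
        ((u ^ (-(k : ℤ) - 1) : Rˣ) : R) := by
      rw [pow_two, ← Units.val_mul, ← Units.val_mul, ← zpow_add, ← zpow_add]
      congr 2
      ring
    rw [D.leibniz_of_mul_eq_one h0, hnat k, ← e]
    simp [mul_assoc]

theorem ddz_laurentFn (n : ℤ) : ddz _ (laurentFn n) = (n : ℂ) • laurentFn (n - 1) := by
  rw [laurentFn, derivation_unit_zpow]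
  have : ddz _ (laurentZ : LaurentRing) = 1 := ddz_coord _
  rw [this, mul_one, laurentFn]

theorem ddz_chiralFn (n m : ℤ) : ddz _ (chiralFn n m) =
    (n : ℂ) • chiralFn (n - 1) m - (m : ℂ) • chiralFn n (m + 1) := by
  have h1 : ddz _ (chiralZ : ChiralRing) = 1 := ddz_coord _
  have h2 : ddz _ (chiralZ1 : ChiralRing) = 1 := by
    change ddz _ (coord _ - 1 : ChiralRing) = 1
    rw [map_sub, ddz_coord, Derivation.map_one_eq_zero, sub_zero]
  rw [chiralFn, Units.val_mul, Derivation.leibniz, derivation_unit_zpow, derivation_unit_zpow, h1,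
    h2, mul_one, mul_one]
  have e : -(m + 1) = -m - 1 := by ring
  simp only [chiralFn, Units.val_mul, smul_eq_mul, e, mul_smul_comm]
  push_cast
  rw [mul_comm (((chiralZ1 ^ (-m) : ChiralRingˣ) : ChiralRing))]
  rw [neg_smul]
  abel

theorem chiralFn_mul (n m s t : ℤ) : chiralFn n m * chiralFn s t = chiralFn (n + s) (m + t) := by
  rw [chiralFn, chiralFn, chiralFn, ← Units.val_mul, zpow_add, neg_add, zpow_add]
  congr 1
  exact mul_mul_mul_comm _ _ _ _

theorem isUnit_aeval_chiral (x : LaurentSeries ℂ) (h0 : x ≠ 0) (h1 : x - 1 ≠ 0) :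
    IsUnit (Polynomial.aeval x (Polynomial.X * (Polynomial.X - 1) : ℂ[X])) := by
  simpa using ⟨h0, h1⟩

theorem single_one_ne (n : ℤ) (hn : n ≠ 0) :
    (HahnSeries.single n (1 : ℂ) : LaurentSeries ℂ) - 1 ≠ 0 := by
  intro h
  have := congrArg (fun f : LaurentSeries ℂ => f.coeff n) h
  simp [HahnSeries.coeff_one, hn] at this

/-- The expansion `ι_{z}` of a Laurent polynomial at `z = 0`. -/
def laurentExpand : LaurentRing →ₐ[ℂ] LaurentSeries ℂ :=
  evalAt _ (HahnSeries.single 1 1) (by simp)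

/-- The expansion `ι_{1,z}` at `z = 0`, in the local coordinate `z`. -/
def expandZero : ChiralRing →ₐ[ℂ] LaurentSeries ℂ :=
  evalAt _ (HahnSeries.single 1 1) (isUnit_aeval_chiral _ (by simp) (single_one_ne 1 (by simp)))

/-- The expansion `ι_{1,z-1}` at `z = 1`, in the local coordinate `z - 1`. -/
def expandOne : ChiralRing →ₐ[ℂ] LaurentSeries ℂ :=
  evalAt _ (1 + HahnSeries.single 1 1) (isUnit_aeval_chiral _ (by
    intro h
    have := congrArg (fun f : LaurentSeries ℂ => f.coeff 1) h
    simp [HahnSeries.coeff_one] at this) (by simp))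

/-- The expansion `ι_{z,1}` at `z = ∞`, in the local coordinate `1 / z`: the coefficient of `zⁿ`
is the coefficient of index `-n` of the series. -/
def expandInfty : ChiralRing →ₐ[ℂ] LaurentSeries ℂ :=
  evalAt _ (HahnSeries.single (-1) 1)
    (isUnit_aeval_chiral _ (by simp) (single_one_ne (-1) (by simp)))

theorem laurentExpand_ddz (f : LaurentRing) (n : ℤ) :
    (laurentExpand (ddz _ f)).coeff n = ((n : ℂ) + 1) * (laurentExpand f).coeff (n + 1) := by
  rw [laurentExpand, evalAt_ddz _ _ _ 1 (by simp [LaurentSeries.derivative_apply]), one_mul,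
    laurent_derivative_coeff]

theorem expandZero_ddz (f : ChiralRing) (n : ℤ) :
    (expandZero (ddz _ f)).coeff n = ((n : ℂ) + 1) * (expandZero f).coeff (n + 1) := by
  rw [expandZero, evalAt_ddz _ _ _ 1 (by simp [LaurentSeries.derivative_apply]), one_mul,
    laurent_derivative_coeff]

theorem expandOne_ddz (f : ChiralRing) (n : ℤ) :
    (expandOne (ddz _ f)).coeff n = ((n : ℂ) + 1) * (expandOne f).coeff (n + 1) := by
  have h1 : LaurentSeries.hasseDeriv ℂ 1 (1 : LaurentSeries ℂ) = 0 := by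
    change LaurentSeries.hasseDeriv ℂ 1 (HahnSeries.single 0 1 : LaurentSeries ℂ) = 0
    rw [LaurentSeries.hasseDeriv_single]
    simp
  rw [expandOne, evalAt_ddz _ _ _ 1 (by simp [LaurentSeries.derivative_apply, h1]), one_mul,
    laurent_derivative_coeff]

theorem expandInfty_ddz (f : ChiralRing) (n : ℤ) :
    (expandInfty (ddz _ f)).coeff n = (1 - (n : ℂ)) * (expandInfty f).coeff (n - 1) := by
  rw [expandInfty, evalAt_ddz _ _ _ (HahnSeries.single 2 (-1))
    (by
      rw [LaurentSeries.derivative_apply, LaurentSeries.hasseDeriv_single,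
        HahnSeries.single_mul_single]
      simp), ← sub_add_cancel n 2, HahnSeries.coeff_single_mul_add,
    laurent_derivative_coeff]
  have : n - 2 + 1 = n - 2 + 2 - 1 := by ring
  rw [this]
  push_cast
  ring

theorem order_unit_zpow {R : Type*} [CommRing R] [Algebra ℂ R] (e : R →ₐ[ℂ] LaurentSeries ℂ)
    (u : Rˣ) (n : ℤ) : (e ((u ^ n : Rˣ) : R)).order = n * (e (u : R)).order := by
  have hnat : ∀ k : ℕ, (e ((u ^ (k : ℤ) : Rˣ) : R)).order = k * (e (u : R)).order := by
    intro k
    rw [zpow_natCast, Units.val_pow_eq_pow_val, map_pow, HahnSeries.order_pow]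
    simp
  obtain ⟨k, rfl | rfl⟩ := n.eq_nat_or_neg
  · exact hnat k
  · have h0 : e ((u ^ (-(k : ℤ)) : Rˣ) : R) * e ((u ^ (k : ℤ) : Rˣ) : R) = 1 := by
      rw [← map_mul, ← Units.val_mul, ← zpow_add]
      simp
    have h1 := congrArg HahnSeries.order h0
    rw [HahnSeries.order_mul (left_ne_zero_of_mul_eq_one h0) (right_ne_zero_of_mul_eq_one h0),
      hnat, HahnSeries.order_one] at h1
    linarith

theorem expandInfty_chiralFn (n m p : ℤ) (hp : p < m - n) :
    (expandInfty (chiralFn n m)).coeff p = 0 := by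
  apply HahnSeries.coeff_eq_zero_of_lt_order
  have h0 : expandInfty (chiralZ : ChiralRing) = HahnSeries.single (-1) 1 := evalAt_coord _ _ _
  have h1 : expandInfty (chiralZ1 : ChiralRing) = HahnSeries.single (-1) 1 - 1 := by
    change expandInfty (coord _ - 1 : ChiralRing) = _
    rw [map_sub, map_one]
    congr 1
  have h2 : (HahnSeries.single (-1) (1 : ℂ) - 1 : LaurentSeries ℂ).order = -1 := by
    apply le_antisymm
    · apply HahnSeries.order_le_of_coeff_ne_zero
      simp [HahnSeries.coeff_one]
    · rw [HahnSeries.le_order_iff_forall (single_one_ne (-1) (by simp))]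
      intro j hj
      have hj1 : j ≠ -1 := by lia
      have hj0 : j ≠ 0 := by lia
      simp [HahnSeries.coeff_one, HahnSeries.coeff_single_of_ne hj1, hj0]
  rw [chiralFn, Units.val_mul, map_mul, HahnSeries.order_mul, order_unit_zpow, order_unit_zpow,
    h0, h1, h2, HahnSeries.order_single one_ne_zero]
  · lia
  · exact ((chiralZ ^ n).isUnit.map expandInfty).ne_zero
  · exact ((chiralZ1 ^ (-m)).isUnit.map expandInfty).ne_zero

section DividedPowers

/-! ### Divided powers of a derivation -/

/-- `D^k / k!` -/
def divPow {R : Type*} [CommRing R] [Algebra ℂ R] (D : Derivation ℂ R R) (k : ℕ) : R →ₗ[ℂ] R :=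
  (k.factorial : ℂ)⁻¹ • (D : R →ₗ[ℂ] R) ^ k

variable {R : Type*} [CommRing R] [Algebra ℂ R] (D : Derivation ℂ R R)

theorem divPow_zero (f : R) : divPow D 0 f = f := by simp [divPow]

theorem divPow_succ (k : ℕ) (f : R) :
    ((k : ℂ) + 1) • divPow D (k + 1) f = D (divPow D k f) := by
  have : ((k : ℂ) + 1) ≠ 0 := by exact_mod_cast k.succ_ne_zero
  simp only [divPow, LinearMap.smul_apply, smul_smul, Nat.factorial_succ, pow_succ', Derivation.map_smul, Module.End.mul_apply, Derivation.coeFn_coe]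
  push_cast
  rw [mul_inv, ← mul_assoc, mul_inv_cancel₀ this, one_mul]

theorem divPow_succ' (k : ℕ) (f : R) :
    ((k : ℂ) + 1) • divPow D (k + 1) f = divPow D k (D f) := by
  have : ((k : ℂ) + 1) ≠ 0 := by exact_mod_cast k.succ_ne_zero
  simp only [divPow, LinearMap.smul_apply, smul_smul, Nat.factorial_succ, pow_succ, Module.End.mul_apply, Derivation.coeFn_coe]
  push_cast
  rw [mul_inv, ← mul_assoc, mul_inv_cancel₀ this, one_mul]

theorem divPow_comp (k l : ℕ) (f : R) :
    divPow D k (divPow D l f) = (k + l).choose k • divPow D (k + l) f := by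
  simp only [divPow, LinearMap.smul_apply, map_smul, smul_smul, ← Module.End.mul_apply, ← pow_add, ← Nat.cast_smul_eq_nsmul ℂ]
  congr 1
  rw [Nat.cast_add_choose]
  have h1 : ((k.factorial : ℂ)) ≠ 0 := by exact_mod_cast k.factorial_ne_zero
  have h2 : ((l.factorial : ℂ)) ≠ 0 := by exact_mod_cast l.factorial_ne_zero
  have h3 : (((k + l).factorial : ℂ)) ≠ 0 := by exact_mod_cast (k + l).factorial_ne_zero
  field_simp

theorem divPow_mul (n : ℕ) (f g : R) :
    divPow D n (f * g) = ∑ ij ∈ Finset.HasAntidiagonal.antidiagonal n, divPow D ij.1 f * divPow D ij.2 g := by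
  induction n with
  | zero => simp [divPow_zero]
  | succ n ih =>
    have hn : ((n : ℂ) + 1) ≠ 0 := by exact_mod_cast n.succ_ne_zero
    apply smul_right_injective R hn
    simp only
    rw [divPow_succ, ih, map_sum]
    simp only [Derivation.leibniz, smul_eq_mul, ← divPow_succ]
    rw [Finset.sum_add_distrib, Finset.smul_sum]
    have e : ∀ ij ∈ Finset.HasAntidiagonal.antidiagonal (n + 1), ((n : ℂ) + 1) • (divPow D ij.1 f * divPow D ij.2 g)
        = (ij.2 : ℂ) • (divPow D ij.1 f * divPow D ij.2 g) +
          (ij.1 : ℂ) • (divPow D ij.1 f * divPow D ij.2 g) := by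
      intro ij hij
      rw [← add_smul]
      congr 1
      rw [Finset.HasAntidiagonal.mem_antidiagonal] at hij
      have : (n : ℂ) + 1 = ij.1 + ij.2 := by exact_mod_cast hij.symm
      rw [this, add_comm]
    rw [Finset.sum_congr rfl e, Finset.sum_add_distrib]
    congr 1
    · rw [Finset.Nat.sum_antidiagonal_succ']
      simp
    · rw [Finset.Nat.sum_antidiagonal_succ]
      simp [mul_comm]

theorem choose_succ_mul (x : ℤ) (k : ℕ) :
    ((k : ℤ) + 1) * Ring.choose x (k + 1) = (x - k) * Ring.choose x k := by
  have := Ring.choose_smul_choose x (n := k + 1) (k := k) (by lia)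
  simpa [mul_comm] using this

/-- If the coefficients of an expansion are compatible with `d/dz`, then they are compatible with
its divided powers. -/
theorem expand_divPow (e : R → ℤ → ℂ) (hadd : ∀ (c : ℂ) f n, e (c • f) n = c * e f n)
    (he : ∀ f n, e (D f) n = ((n : ℂ) + 1) * e f (n + 1)) (k : ℕ) (f : R) (n : ℤ) :
    e (divPow D k f) n = (Ring.choose (n + k) k : ℤ) * e f (n + k) := by
  induction k generalizing n with
  | zero => simp [divPow_zero]
  | succ k ih =>
    have hn : ((k : ℂ) + 1) ≠ 0 := by exact_mod_cast k.succ_ne_zero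
    apply mul_left_cancel₀ hn
    rw [← hadd, divPow_succ, he, ih]
    have h1 := choose_succ_mul (n + 1 + k) k
    have h2 : (((k : ℤ) + 1 : ℤ) : ℂ) * (Ring.choose (n + 1 + k) (k + 1) : ℤ) =
      ((n + 1 + k - k : ℤ) : ℂ) * (Ring.choose (n + 1 + k) k : ℤ) := by exact_mod_cast h1
    have h3 : n + ((k + 1 : ℕ) : ℤ) = n + 1 + k := by push_cast; ring
    rw [h3, ← mul_assoc, ← mul_assoc]
    congr 1
    push_cast at h2
    rw [h2]
    ring

end DividedPowers

theorem divPow_mul_alt {R : Type*} [CommRing R] [Algebra ℂ R] (D : Derivation ℂ R R) (n : ℕ)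
    (f g : R) : ∑ ij ∈ Finset.HasAntidiagonal.antidiagonal n,
      (-1 : ℂ) ^ ij.2 • divPow D ij.1 (f * divPow D ij.2 g) = divPow D n f * g := by
  induction n generalizing g with
  | zero => simp [divPow_zero]
  | succ n ih =>
    have hn : ((n : ℂ) + 1) ≠ 0 := by exact_mod_cast n.succ_ne_zero
    apply smul_right_injective R hn
    simp only
    have h1 : ((n : ℂ) + 1) • (divPow D (n + 1) f * g) =
        D (divPow D n f * g) - divPow D n f * D g := by
      rw [D.leibniz, ← smul_mul_assoc, divPow_succ]
      simp [mul_comm]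
    rw [h1, ← ih g, ← ih (D g), map_sum]
    simp only [Derivation.map_smul, ← divPow_succ, ← divPow_succ', mul_smul_comm, map_smul]
    rw [Finset.smul_sum]
    have e : ∀ ij ∈ Finset.HasAntidiagonal.antidiagonal (n + 1),
        ((n : ℂ) + 1) • ((-1 : ℂ) ^ ij.2 • divPow D ij.1 (f * divPow D ij.2 g))
        = (-1 : ℂ) ^ ij.2 • (ij.1 : ℂ) • divPow D ij.1 (f * divPow D ij.2 g) +
          (-1 : ℂ) ^ ij.2 • (ij.2 : ℂ) • divPow D ij.1 (f * divPow D ij.2 g) := by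
      intro ij hij
      rw [Finset.HasAntidiagonal.mem_antidiagonal] at hij
      have : (n : ℂ) + 1 = ij.1 + ij.2 := by exact_mod_cast hij.symm
      rw [this, ← smul_add, ← add_smul, smul_comm]
    rw [Finset.sum_congr rfl e, Finset.sum_add_distrib, sub_eq_add_neg]
    congr 1
    · rw [Finset.Nat.sum_antidiagonal_succ]
      simp
    · rw [Finset.Nat.sum_antidiagonal_succ', ← Finset.sum_neg_distrib]
      simp [pow_succ]

/-! ### Vertex operator algebras and their modules -/

/-- Vertex operator algebras over `ℂ`. The mode `a(n)` is `ncoeff (Y a) n`, so that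
`Y(a, z) = ∑ a(n) z^(-n-1)`; the truncation property is part of the type of `Y`. The Jacobi
identity is stated in components. -/
class VertexOperatorAlgebra (V : Type*) [AddCommGroup V] [Module ℂ V] where
  /-- the homogeneous subspaces `V_n` -/
  grade : ℤ → Submodule ℂ V
  isInternal : DirectSum.IsInternal grade
  finiteDimensional : ∀ n, FiniteDimensional ℂ (grade n)
  bddBelow : ∃ N : ℤ, ∀ n < N, grade n = ⊥
  /-- the state-field correspondence -/
  Y : V →ₗ[ℂ] VertexOperator ℂ V
  /-- the vacuum element -/
  vac : V
  /-- the Virasoro element -/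
  omega : V
  vac_mem : vac ∈ grade 0
  omega_mem : omega ∈ grade 2
  vacuum : ∀ (n : ℤ) (a : V), (Y vac).ncoeff n a = if n = -1 then a else 0
  creation : ∀ a : V, (Y a).ncoeff (-1) vac = a ∧ ∀ n : ℤ, 0 ≤ n → (Y a).ncoeff n vac = 0
  jacobi : ∀ (a b c : V) (l m n : ℤ),
    (∑ᶠ i : ℕ, ((-1 : ℂ) ^ i * (Ring.choose l i : ℤ)) •
        (Y a).ncoeff (m + l - i) ((Y b).ncoeff (n + i) c)) -
      (∑ᶠ i : ℕ, ((-1 : ℂ) ^ (l + i) * (Ring.choose l i : ℤ)) •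
        (Y b).ncoeff (n + l - i) ((Y a).ncoeff (m + i) c)) =
    ∑ᶠ i : ℕ, ((Ring.choose m i : ℤ) : ℂ) • (Y ((Y a).ncoeff (l + i) b)).ncoeff (m + n - i) c
  /-- the central charge -/
  charge : ℂ
  virasoro : ∀ (m n : ℤ) (v : V),
    (Y omega).ncoeff (m + 1) ((Y omega).ncoeff (n + 1) v) -
      (Y omega).ncoeff (n + 1) ((Y omega).ncoeff (m + 1) v) =
    ((m : ℂ) - n) • (Y omega).ncoeff (m + n + 1) v +
      (if m + n = 0 then ((m : ℂ) ^ 3 - m) / 12 * charge else 0) • v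
  deriv : ∀ (a : V) (n : ℤ),
    (Y ((Y omega).ncoeff 0 a)).ncoeff n = -(n : ℂ) • (Y a).ncoeff (n - 1)
  weight : ∀ (n : ℤ), ∀ a ∈ grade n, (Y omega).ncoeff 1 a = (n : ℂ) • a

/-- The operation `(a, b) ↦ a(n) b` on a vertex operator algebra. -/
def vmode {V : Type*} [AddCommGroup V] [Module ℂ V] [VertexOperatorAlgebra V] (n : ℤ) :
    V →ₗ[ℂ] Module.End ℂ V :=
  LinearMap.proj n ∘ₗ VertexOperator.ncoeff ∘ₗ VertexOperatorAlgebra.Y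

/-- The space `M(n)` of an `ℕ`-graded space, which is `0` for `n < 0`. -/
def extendGrade {M : Type*} [AddCommGroup M] [Module ℂ M] (g : ℕ → Submodule ℂ M) (n : ℤ) :
    Submodule ℂ M :=
  if 0 ≤ n then g n.toNat else ⊥

/-- Admissible modules over a vertex operator algebra. -/
class AdmissibleModule (V : Type*) [AddCommGroup V] [Module ℂ V] [VertexOperatorAlgebra V]
    (M : Type*) [AddCommGroup M] [Module ℂ M] where
  /-- the homogeneous subspaces `M(n)` -/
  grade : ℕ → Submodule ℂ M
  isInternal : DirectSum.IsInternal grade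
  /-- the module vertex operator -/
  Y : V →ₗ[ℂ] VertexOperator ℂ M
  vacuum : ∀ (n : ℤ) (u : M),
    (Y VertexOperatorAlgebra.vac).ncoeff n u = if n = -1 then u else 0
  jacobi : ∀ (a b : V) (u : M) (l m n : ℤ),
    (∑ᶠ i : ℕ, ((-1 : ℂ) ^ i * (Ring.choose l i : ℤ)) •
        (Y a).ncoeff (m + l - i) ((Y b).ncoeff (n + i) u)) -
      (∑ᶠ i : ℕ, ((-1 : ℂ) ^ (l + i) * (Ring.choose l i : ℤ)) •
        (Y b).ncoeff (n + l - i) ((Y a).ncoeff (m + i) u)) =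
    ∑ᶠ i : ℕ, ((Ring.choose m i : ℤ) : ℂ) • (Y (vmode (l + i) a b)).ncoeff (m + n - i) u
  deriv : ∀ (a : V) (n : ℤ),
    (Y (vmode 0 VertexOperatorAlgebra.omega a)).ncoeff n = -(n : ℂ) • (Y a).ncoeff (n - 1)
  mode_mem : ∀ (k : ℤ), ∀ a ∈ VertexOperatorAlgebra.grade (V := V) k, ∀ (m : ℤ) (n : ℕ),
    ∀ u ∈ grade n, (Y a).ncoeff m u ∈ extendGrade grade (n + k - m - 1)

/-- The operation `(a, u) ↦ a(n) u` on a module. -/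
def mmode (V : Type*) [AddCommGroup V] [Module ℂ V] [VertexOperatorAlgebra V] (M : Type*)
    [AddCommGroup M] [Module ℂ M] [AdmissibleModule V M] (n : ℤ) : V →ₗ[ℂ] Module.End ℂ M :=
  LinearMap.proj n ∘ₗ VertexOperator.ncoeff ∘ₗ AdmissibleModule.Y

/-- An admissible module is ordinary if `M(n)` is a finite-dimensional eigenspace of `L(0)` of
eigenvalue `h + n`. -/
structure IsOrdinary (V : Type*) [AddCommGroup V] [Module ℂ V] [VertexOperatorAlgebra V]
    (M : Type*) [AddCommGroup M] [Module ℂ M] [AdmissibleModule V M] : Prop where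
  finiteDimensional : ∀ n, FiniteDimensional ℂ (AdmissibleModule.grade V (M := M) n)
  exists_conformalWeight : ∃ h : ℂ, ∀ n, AdmissibleModule.grade V (M := M) n =
    Module.End.eigenspace (mmode V M 1 VertexOperatorAlgebra.omega) (h + n)

/-! ### The commutator formula -/

section Modes

variable {V W : Type*} [AddCommGroup V] [Module ℂ V] [AddCommGroup W] [Module ℂ W]

/-- The truncation property of a family of operators. -/
def Truncated (φ : ℤ → V →ₗ[ℂ] Module.End ℂ W) : Prop :=
  ∀ a w, ∃ N : ℤ, ∀ n, N ≤ n → φ n a w = 0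

/-- The commutator formula, for the products `ψ` on `V` and operators `φ` on `W`. -/
def CommutatorFormula (ψ : ℤ → V →ₗ[ℂ] Module.End ℂ V) (φ : ℤ → V →ₗ[ℂ] Module.End ℂ W) : Prop :=
  ∀ a b p q w, φ p a (φ q b w) - φ q b (φ p a w) =
    ∑ᶠ k : ℕ, ((Ring.choose p k : ℤ) : ℂ) • φ (p + q - k) (ψ k a b) w

theorem finite_of_box {E : Type*} [AddCommMonoid E] (X : ℤ × ℤ → E) (a b c d : ℤ)
    (h : ∀ x, X x ≠ 0 → (a ≤ x.1 ∧ x.1 < b) ∧ (c ≤ x.2 ∧ x.2 < d)) : Function.HasFiniteSupport X :=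
  ((Set.finite_Ico a b).prod (Set.finite_Ico c d)).subset fun x hx => h x hx

theorem exists_uniform_bound {ι : Type*} (s : Finset ι) (P : ι → ℤ → Prop)
    (h : ∀ i ∈ s, ∃ N, ∀ n, N ≤ n → P i n) : ∃ N, ∀ i ∈ s, ∀ n, N ≤ n → P i n := by
  classical
  choose! N hN using h
  obtain ⟨B, hB⟩ := (s.image N).bddAbove
  refine ⟨B, fun i hi n hn => hN i hi n (le_trans (hB ?_) hn)⟩
  exact_mod_cast Finset.mem_image_of_mem N hi

theorem double_support {S E : Type*} [CommRing S] [Module ℂ S] [AddCommGroup E] [Module ℂ E]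
    {φ : ℤ → V →ₗ[ℂ] Module.End ℂ W} (hφ : Truncated φ) (β : W →ₗ[ℂ] S →ₗ[ℂ] E) (a b : V) (w : W)
    (F G : ℤ → S) (f₀ g₀ : ℤ) (hF : ∀ n < f₀, F n = 0) (hG : ∀ n < g₀, G n = 0) :
    ∃ P Q : ℤ, ∀ p q, β (φ p a (φ q b w)) (F p * G q) ≠ 0 →
      (f₀ ≤ p ∧ p < P) ∧ (g₀ ≤ q ∧ q < Q) := by
  obtain ⟨Q, hQ⟩ := hφ b w
  obtain ⟨P, hP⟩ := exists_uniform_bound (Finset.Ico g₀ Q)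
    (fun q n => φ n a (φ q b w) = 0) (fun q _ => hφ a (φ q b w))
  refine ⟨P, Q, fun p q hne => ?_⟩
  have h1 : f₀ ≤ p := by
    by_contra hc
    exact hne (by simp [hF p (by lia)])
  have h2 : g₀ ≤ q := by
    by_contra hc
    exact hne (by simp [hG q (by lia)])
  have h3 : q < Q := by
    by_contra hc
    exact hne (by simp [hQ q (by lia)])
  have h4 : p < P := by
    by_contra hc
    exact hne (by simp [hP q (by simp [h2, h3]) p (by lia)])
  exact ⟨⟨h1, h4⟩, h2, h3⟩

theorem commutator_expand {S E : Type*} [CommRing S] [Algebra ℂ S] [AddCommGroup E] [Module ℂ E]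
    {ψ : ℤ → V →ₗ[ℂ] Module.End ℂ V} {φ : ℤ → V →ₗ[ℂ] Module.End ℂ W}
    (hψ : Truncated ψ) (hφ : Truncated φ) (hc : CommutatorFormula ψ φ)
    (β : W →ₗ[ℂ] S →ₗ[ℂ] E) (a b : V) (w : W)
    (F G : ℤ → S) (f₀ g₀ : ℤ) (hF : ∀ n < f₀, F n = 0) (hG : ∀ n < g₀, G n = 0) :
    (∑ᶠ q : ℤ, ∑ᶠ p : ℤ, β (φ p a (φ q b w)) (F p * G q)) -
      (∑ᶠ p : ℤ, ∑ᶠ q : ℤ, β (φ q b (φ p a w)) (F p * G q)) =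
    ∑ᶠ k : ℕ, ∑ᶠ r : ℤ, β (φ r (ψ k a b) w)
      (∑ᶠ p : ℤ, ((Ring.choose p k : ℤ) : ℂ) • (F p * G (r + k - p))) := by
  obtain ⟨P, Q, hX⟩ := double_support hφ β a b w F G f₀ g₀ hF hG
  obtain ⟨Q', P', hY⟩ := double_support hφ β b a w G F g₀ f₀ hG hF
  have hXs : Function.HasFiniteSupport
      (fun x : ℤ × ℤ => β (φ x.2 a (φ x.1 b w)) (F x.2 * G x.1)) :=
    finite_of_box _ g₀ Q f₀ P fun x hx => (hX _ _ hx).symm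
  have hXs' : Function.HasFiniteSupport
      (fun x : ℤ × ℤ => β (φ x.1 a (φ x.2 b w)) (F x.1 * G x.2)) :=
    finite_of_box _ f₀ P g₀ Q fun x hx => hX _ _ hx
  have hYs : Function.HasFiniteSupport
      (fun x : ℤ × ℤ => β (φ x.2 b (φ x.1 a w)) (F x.1 * G x.2)) :=
    finite_of_box _ f₀ P' g₀ Q' fun x hx => (hY x.2 x.1 (by rwa [mul_comm])).symm
  rw [← finsum_curry _ hXs, ← finsum_curry _ hYs,
    ← finsum_comp_equiv (Equiv.prodComm ℤ ℤ)]
  simp only [Equiv.prodComm_apply, Prod.fst_swap, Prod.snd_swap]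
  rw [← finsum_sub_distrib hXs' hYs]
  obtain ⟨K, hK⟩ := hψ a b
  have hKn : ∀ k : ℕ, k ∉ Finset.range K.toNat → ψ k a b = 0 := by
    intro k hk
    apply hK
    simp only [Finset.mem_range, not_lt] at hk
    lia
  have hZ : ∀ k : ℕ, Function.HasFiniteSupport (fun x : ℤ × ℤ =>
      β (φ (x.1 + x.2 - k) (ψ k a b) w) (((Ring.choose x.1 k : ℤ) : ℂ) • (F x.1 * G x.2))) := by
    intro k
    obtain ⟨N, hN⟩ := hφ (ψ k a b) w
    refine finite_of_box _ f₀ (N + k - g₀) g₀ (N + k - f₀) fun x hx => ?_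
    have h1 : f₀ ≤ x.1 := by
      by_contra hc
      exact hx (by simp [hF x.1 (by lia)])
    have h2 : g₀ ≤ x.2 := by
      by_contra hc
      exact hx (by simp [hG x.2 (by lia)])
    have h3 : x.1 + x.2 - k < N := by
      by_contra hc
      exact hx (by simp [hN (x.1 + x.2 - k) (by lia)])
    refine ⟨⟨h1, ?_⟩, h2, ?_⟩ <;> lia
  have hD : ∀ x : ℤ × ℤ, β (φ x.1 a (φ x.2 b w)) (F x.1 * G x.2) -
      β (φ x.2 b (φ x.1 a w)) (F x.1 * G x.2) = ∑ k ∈ Finset.range K.toNat,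
      β (φ (x.1 + x.2 - k) (ψ k a b) w) (((Ring.choose x.1 k : ℤ) : ℂ) • (F x.1 * G x.2)) := by
    intro x
    rw [← LinearMap.sub_apply, ← map_sub, hc, finsum_eq_sum_of_support_subset
      (s := Finset.range K.toNat), map_sum, LinearMap.sum_apply]
    · refine Finset.sum_congr rfl fun k _ => ?_
      rw [map_smul, LinearMap.smul_apply, map_smul]
    · intro k hk
      by_contra hc
      exact hk (by simp [hKn k (by simpa using hc)])
  rw [finsum_congr hD, finsum_sum_comm _ _ (fun k _ => hZ k),
    finsum_eq_sum_of_support_subset (s := Finset.range K.toNat)]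
  · refine Finset.sum_congr rfl fun k _ => ?_
    let e : ℤ × ℤ ≃ ℤ × ℤ :=
      { toFun := fun x => (x.2, x.1 + k - x.2)
        invFun := fun y => (y.1 + y.2 - k, y.1)
        left_inv := fun x => by ext <;> simp
        right_inv := fun y => by ext <;> simp }
    have hfin := (hZ k)
    rw [← finsum_comp_equiv e]
    have hZ' : Function.HasFiniteSupport (fun x : ℤ × ℤ => β (φ ((e x).1 + (e x).2 - k) (ψ k a b) w)
        (((Ring.choose (e x).1 k : ℤ) : ℂ) • (F (e x).1 * G (e x).2))) := by
      have : (Function.support (fun x : ℤ × ℤ => β (φ ((e x).1 + (e x).2 - k) (ψ k a b) w)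
        (((Ring.choose (e x).1 k : ℤ) : ℂ) • (F (e x).1 * G (e x).2)))) ⊆ e ⁻¹' (Function.support (fun x : ℤ × ℤ =>
      β (φ (x.1 + x.2 - k) (ψ k a b) w) (((Ring.choose x.1 k : ℤ) : ℂ) • (F x.1 * G x.2)))) :=
        fun x hx => hx
      exact (Set.Finite.preimage e.injective.injOn hfin).subset this
    rw [finsum_curry _ hZ']
    refine finsum_congr fun r => ?_
    rw [map_finsum]
    · refine finsum_congr fun p => ?_
      have : p + (r + k - p) - k = r := by ring
      simp only [e, Equiv.coe_fn_mk, this]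
    · refine finsum_finite_of_bdd _ f₀ (r + k - g₀ + 1) ?_
      rintro p (hp | hp)
      · simp [hF p hp]
      · simp [hG (r + k - p) (by lia)]
  · intro k hk
    by_contra hc
    exact hk (by simp [hKn k (by simpa using hc)])

/-- The residue pairing `a ⊗ f ↦ ∑ f_n a(n)` of a truncated family of operators with the Laurent
expansions `f = ∑ f_n zⁿ`, i.e. `Res Y(a, z) f(z)`. -/
def residue (φ : ℤ → V →ₗ[ℂ] Module.End ℂ W) (hφ : Truncated φ) :
    V →ₗ[ℂ] LaurentSeries ℂ →ₗ[ℂ] Module.End ℂ W :=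
  have fin : ∀ a (f : LaurentSeries ℂ) w,
      Function.HasFiniteSupport (fun n : ℤ => f.coeff n • φ n a w) := fun a f w => by
    obtain ⟨A, hA⟩ := laurent_bddBelow f
    obtain ⟨B, hB⟩ := hφ a w
    refine finsum_finite_of_bdd _ A B ?_
    rintro n (hn | hn)
    · simp [hA n hn]
    · simp [hB n hn]
  LinearMap.mk₂ ℂ
    (fun a f =>
      { toFun := fun w => ∑ᶠ n : ℤ, f.coeff n • φ n a w
        map_add' := fun w w' => by
          rw [← finsum_add_distrib (fin _ _ _) (fin _ _ _)]
          simp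
        map_smul' := fun c w => by
          rw [RingHom.id_apply, smul_finsum]
          simp [smul_comm c] })
    (fun a a' f => by
      ext w
      simp only [LinearMap.coe_mk, AddHom.coe_mk, LinearMap.add_apply]
      rw [← finsum_add_distrib (fin _ _ _) (fin _ _ _)]
      simp)
    (fun c a f => by
      ext w
      simp only [LinearMap.coe_mk, AddHom.coe_mk, LinearMap.smul_apply]
      rw [smul_finsum]
      simp [smul_comm c])
    (fun a f f' => by
      ext w
      simp only [LinearMap.coe_mk, AddHom.coe_mk, LinearMap.add_apply]
      rw [← finsum_add_distrib (fin _ _ _) (fin _ _ _)]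
      simp [add_smul])
    (fun c a f => by
      ext w
      simp only [LinearMap.coe_mk, AddHom.coe_mk, LinearMap.smul_apply]
      rw [smul_finsum]
      simp [mul_smul])

theorem residue_apply (φ : ℤ → V →ₗ[ℂ] Module.End ℂ W) (hφ : Truncated φ) (a : V)
    (f : LaurentSeries ℂ) (w : W) : residue φ hφ a f w = ∑ᶠ n : ℤ, f.coeff n • φ n a w := rfl

theorem residue_finite {φ : ℤ → V →ₗ[ℂ] Module.End ℂ W} (hφ : Truncated φ) (a : V)
    (f : LaurentSeries ℂ) (w : W) :
    Function.HasFiniteSupport (fun n : ℤ => f.coeff n • φ n a w) := by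
  obtain ⟨A, hA⟩ := laurent_bddBelow f
  obtain ⟨B, hB⟩ := hφ a w
  refine finsum_finite_of_bdd _ A B ?_
  rintro n (hn | hn)
  · simp [hA n hn]
  · simp [hB n hn]

end Modes

theorem laurent_map_smul {R : Type*} [CommRing R] [Algebra ℂ R] (e : R →ₐ[ℂ] LaurentSeries ℂ)
    (c : ℂ) (f : R) : e (c • f) = HahnSeries.C c * e f := by
  rw [Algebra.smul_def, map_mul, AlgHom.commutes, HahnSeries.algebraMap_apply',
    PowerSeries.algebraMap_eq]
  simp

/-- A homomorphism to Laurent series as a linear map for the coefficientwise structure. -/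
def laurentLinear {R : Type*} [CommRing R] [Algebra ℂ R] (e : R →ₐ[ℂ] LaurentSeries ℂ) :
    R →ₗ[ℂ] LaurentSeries ℂ where
  toFun := e
  map_add' := map_add e
  map_smul' c f := by rw [laurent_map_smul, HahnSeries.C_mul_eq_smul, RingHom.id_apply]

section ModesTwo

variable {V W : Type*} [AddCommGroup V] [Module ℂ V] [AddCommGroup W] [Module ℂ W]

theorem residue_commutator {R : Type*} [CommRing R] [Algebra ℂ R] (D : Derivation ℂ R R)
    (e : R →ₐ[ℂ] LaurentSeries ℂ)
    (he : ∀ f n, (e (D f)).coeff n = ((n : ℂ) + 1) * (e f).coeff (n + 1))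
    {ψ : ℤ → V →ₗ[ℂ] Module.End ℂ V} {φ : ℤ → V →ₗ[ℂ] Module.End ℂ W}
    (hψ : Truncated ψ) (hφ : Truncated φ) (hc : CommutatorFormula ψ φ) (a b : V) (f g : R) (w : W) :
    residue φ hφ a (e f) (residue φ hφ b (e g) w) - residue φ hφ b (e g) (residue φ hφ a (e f) w) =
      ∑ᶠ k : ℕ, residue φ hφ (ψ k a b) (e (divPow D k f * g)) w := by
  obtain ⟨f₀, hF⟩ := laurent_bddBelow (e f)
  obtain ⟨g₀, hG⟩ := laurent_bddBelow (e g)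
  have h := commutator_expand hψ hφ hc (LinearMap.lsmul ℂ W).flip a b w (e f).coeff (e g).coeff
    f₀ g₀ hF hG
  simp only [LinearMap.flip_apply, LinearMap.lsmul_apply, smul_eq_mul] at h
  have h1 : ∀ (a b : V) (f g : LaurentSeries ℂ), residue φ hφ a f (residue φ hφ b g w) =
      ∑ᶠ q : ℤ, ∑ᶠ p : ℤ, (f.coeff p * g.coeff q) • φ p a (φ q b w) := by
    intro a b f g
    rw [residue_apply φ hφ b, map_finsum _ (residue_finite hφ b _ w)]
    refine finsum_congr fun q => ?_
    rw [map_smul, residue_apply, smul_finsum]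
    refine finsum_congr fun p => ?_
    rw [smul_smul, mul_comm]
  rw [h1, h1]
  have h2 : ∀ p q : ℤ, ((e g).coeff q * (e f).coeff p) • φ q b (φ p a w) =
      ((e f).coeff p * (e g).coeff q) • φ q b (φ p a w) := fun p q => by rw [mul_comm]
  simp only [h2]
  rw [h]
  refine finsum_congr fun k => ?_
  rw [residue_apply]
  refine finsum_congr fun r => ?_
  congr 1
  rw [map_mul, laurent_coeff_mul, ← finsum_comp_equiv (Equiv.addRight (k : ℤ))]
  refine finsum_congr fun p => ?_
  have h3 := expand_divPow D (fun f n => (e f).coeff n) (fun c f n => by simp [laurent_map_smul]) he k f p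
  have h4 : r + k - (p + k) = r - p := by ring
  simp only [Equiv.coe_addRight]
  rw [h3, h4, mul_assoc]

/-- The operator `∇ = T ⊗ 1 + 1 ⊗ D`. -/
def nabla {R : Type*} [CommRing R] [Algebra ℂ R] (T : Module.End ℂ V) (D : Derivation ℂ R R) :
    V ⊗[ℂ] R →ₗ[ℂ] V ⊗[ℂ] R :=
  TensorProduct.map T LinearMap.id + TensorProduct.map LinearMap.id (D : R →ₗ[ℂ] R)

/-- The operators `a ⊗ f ↦ Res Y(a, z) f(z)`. -/
def residueMap {R : Type*} [CommRing R] [Algebra ℂ R] (φ : ℤ → V →ₗ[ℂ] Module.End ℂ W)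
    (hφ : Truncated φ) (e : R →ₐ[ℂ] LaurentSeries ℂ) : V ⊗[ℂ] R →ₗ[ℂ] Module.End ℂ W :=
  TensorProduct.lift ((residue φ hφ).compl₂ (laurentLinear e))

theorem residueMap_tmul {R : Type*} [CommRing R] [Algebra ℂ R] (φ : ℤ → V →ₗ[ℂ] Module.End ℂ W)
    (hφ : Truncated φ) (e : R →ₐ[ℂ] LaurentSeries ℂ) (a : V) (f : R) :
    residueMap φ hφ e (a ⊗ₜ f) = residue φ hφ a (e f) := rfl

theorem residueMap_nabla {R : Type*} [CommRing R] [Algebra ℂ R] (D : Derivation ℂ R R)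
    (T : Module.End ℂ V) (φ : ℤ → V →ₗ[ℂ] Module.End ℂ W) (hφ : Truncated φ)
    (e : R →ₐ[ℂ] LaurentSeries ℂ)
    (he : ∀ f n, (e (D f)).coeff n = ((n : ℂ) + 1) * (e f).coeff (n + 1))
    (hT : ∀ a n, φ n (T a) = -(n : ℂ) • φ (n - 1) a) (x : V ⊗[ℂ] R) :
    residueMap φ hφ e (nabla T D x) = 0 := by
  induction x using TensorProduct.induction_on with
  | zero => simp
  | add x y hx hy => rw [map_add, map_add, hx, hy, add_zero]
  | tmul a f =>
    ext w
    simp only [nabla, LinearMap.add_apply, TensorProduct.map_tmul, LinearMap.id_apply, map_add,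
      residueMap_tmul, residue_apply, LinearMap.zero_apply, Derivation.coeFn_coe]
    rw [← finsum_comp_equiv (Equiv.addRight (1 : ℤ)) (f := fun n => (e f).coeff n • φ n (T a) w),
      ← finsum_add_distrib]
    · rw [← finsum_zero (α := ℤ)]
      refine finsum_congr fun n => ?_
      simp only [Equiv.coe_addRight, hT, he, add_sub_cancel_right, LinearMap.smul_apply, smul_smul,
        ← add_smul]
      push_cast
      ring_nf
      simp
    · exact Function.HasFiniteSupport.comp_of_injective (Equiv.injective _) (residue_finite hφ _ _ w)
    · exact residue_finite hφ _ _ w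

end ModesTwo

/-! ### Consequences of the Jacobi identity -/

section VOA

variable {V : Type*} [AddCommGroup V] [Module ℂ V] [VertexOperatorAlgebra V]

open VertexOperatorAlgebra

/-- The Virasoro operators `L(n)` on a vertex operator algebra. -/
def vL (V : Type*) [AddCommGroup V] [Module ℂ V] [VertexOperatorAlgebra V] (n : ℤ) :
    Module.End ℂ V := vmode (n + 1) omega

theorem ncoeff_truncated {A M : Type*} [AddCommGroup A] [Module ℂ A] [AddCommGroup M] [Module ℂ M]
    (Y : A →ₗ[ℂ] VertexOperator ℂ M) (a : A) (u : M) :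
    ∃ N : ℤ, ∀ n, N ≤ n → (Y a).ncoeff n u = 0 := by
  refine ⟨-((HahnModule.of ℂ).symm (Y a u)).order, fun n hn => ?_⟩
  exact VertexOperator.ncoeff_eq_zero_of_lt_order _ _ _ (by lia)

theorem vmode_apply (n : ℤ) (a b : V) : vmode n a b = (Y a).ncoeff n b := rfl

theorem mmode_apply (M : Type*) [AddCommGroup M] [Module ℂ M] [AdmissibleModule V M] (n : ℤ)
    (a : V) (u : M) : mmode V M n a u = (AdmissibleModule.Y a).ncoeff n u := rfl

theorem vmode_truncated : Truncated (vmode (V := V)) := fun a u => ncoeff_truncated Y a u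

theorem mmode_truncated (M : Type*) [AddCommGroup M] [Module ℂ M] [AdmissibleModule V M] :
    Truncated (mmode V M) := fun a u => ncoeff_truncated AdmissibleModule.Y a u

theorem finsum_nat_zero {M : Type*} [AddCommMonoid M] (φ : ℕ → M) (h : ∀ i, i ≠ 0 → φ i = 0) :
    ∑ᶠ i, φ i = φ 0 := finsum_eq_single _ _ h

theorem choose_zero_of_ne (i : ℕ) (hi : i ≠ 0) : Ring.choose (0 : ℤ) i = 0 := by
  rw [Ring.choose_zero_ite, if_neg hi]

theorem vmode_commutator : CommutatorFormula (vmode (V := V)) (vmode (V := V)) := by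
  intro a b p q w
  have h := jacobi a b w 0 p q
  rw [finsum_nat_zero _ (fun i hi => by simp [choose_zero_of_ne i hi]),
    finsum_nat_zero _ (fun i hi => by simp [choose_zero_of_ne i hi])] at h
  simpa [vmode_apply] using h

theorem mmode_commutator (M : Type*) [AddCommGroup M] [Module ℂ M] [AdmissibleModule V M] :
    CommutatorFormula (vmode (V := V)) (mmode V M) := by
  intro a b p q w
  have h := AdmissibleModule.jacobi a b w 0 p q
  rw [finsum_nat_zero _ (fun i hi => by simp [choose_zero_of_ne i hi]),
    finsum_nat_zero _ (fun i hi => by simp [choose_zero_of_ne i hi])] at h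
  simpa [vmode_apply, mmode_apply] using h

theorem vmode_translation (a : V) (n : ℤ) :
    vmode n (vL V (-1) a) = -(n : ℂ) • vmode (n - 1) a := deriv a n

theorem mmode_translation (M : Type*) [AddCommGroup M] [Module ℂ M] [AdmissibleModule V M]
    (a : V) (n : ℤ) : mmode V M n (vL V (-1) a) = -(n : ℂ) • mmode V M (n - 1) a :=
  AdmissibleModule.deriv a n

theorem translation_commutator (a b : V) (n : ℤ) :
    vL V (-1) (vmode n a b) - vmode n a (vL V (-1) b) = vmode n (vL V (-1) a) b := by
  have h := vmode_commutator (V := V) omega a 0 n b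
  rw [finsum_nat_zero _ (fun i hi => by simp [choose_zero_of_ne i hi])] at h
  simpa [vL] using h

/-- `vmode (-i-1) a 1 = L(-1)^i a / i!` -/
theorem vmode_vac (a : V) (i : ℕ) :
    vmode (-1 - (i : ℤ)) a (vac : V) = ((i.factorial : ℂ)⁻¹ • (vL V (-1)) ^ i) a := by
  induction i generalizing a with
  | zero => simpa [vmode_apply] using (creation a).1
  | succ i ih =>
    have h := congrArg (fun k : Module.End ℂ V => k vac) (vmode_translation a (-1 - (i : ℤ)))
    simp only [ih, LinearMap.smul_apply] at h
    have hi : ((i : ℂ) + 1) ≠ 0 := by exact_mod_cast i.succ_ne_zero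
    have e : -1 - (i : ℤ) - 1 = -1 - ((i + 1 : ℕ) : ℤ) := by push_cast; ring
    have e2 : -((-1 - (i : ℤ) : ℤ) : ℂ) = (i : ℂ) + 1 := by push_cast; ring
    rw [e, e2] at h
    apply smul_right_injective V hi
    simp only
    rw [← h, LinearMap.smul_apply, smul_smul, Nat.factorial_succ, pow_succ, Module.End.mul_apply]
    push_cast
    rw [mul_inv, ← mul_assoc, mul_inv_cancel₀ hi, one_mul]

theorem choose_neg_one (i : ℕ) : Ring.choose (-1 : ℤ) i = (-1) ^ i := by
  rw [Ring.choose_neg]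
  have : (1 : ℤ) + i - 1 = ((i : ℕ) : ℤ) := by ring
  rw [this, Ring.choose_natCast]
  simp [Int.negOnePow, Units.smul_def]

theorem vmode_skew (a b : V) (j : ℕ) : vmode (j : ℤ) b a =
    ∑ᶠ i : ℕ, (-1 : ℂ) ^ (i + j + 1) •
      ((i.factorial : ℂ)⁻¹ • (vL V (-1)) ^ i) (vmode ((j + i : ℕ) : ℤ) a b) := by
  have h := jacobi a b vac j (-1) 0
  have h1 : ∀ i : ℕ, (Y b).ncoeff (0 + (i : ℤ)) (vac : V) = 0 := fun i => (creation b).2 _ (by simp)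
  have h2 : ∀ i : ℕ, i ≠ 0 → (Y a).ncoeff (-1 + (i : ℤ)) (vac : V) = 0 := fun i hi =>
    (creation a).2 _ (by lia)
  rw [finsum_eq_zero_of_forall_eq_zero (fun i => by rw [h1, map_zero, smul_zero]),
    finsum_nat_zero _ (fun i hi => by rw [h2 i hi, map_zero, smul_zero])] at h
  have h3 : (Y a).ncoeff (-1) (vac : V) = a := (creation a).1
  simp only [Nat.cast_zero, add_zero, sub_zero, zero_add, Ring.choose_zero_right, h3,
    Int.cast_one, mul_one, zero_sub, choose_neg_one, zpow_natCast] at h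
  have h4 : ((-1 : ℂ) ^ (j + 1)) • ((-1 : ℂ) ^ j • (Y b).ncoeff (j : ℤ) a) =
      -((Y b).ncoeff (j : ℤ) a) := by
    rw [smul_smul, ← pow_add]
    have : j + 1 + j = 2 * j + 1 := by ring
    rw [this, pow_succ, pow_mul]
    simp
  have h5 := congrArg (fun x => (-1 : ℂ) ^ (j + 1) • x) h
  simp only [smul_neg, h4, neg_neg] at h5
  refine h5.trans ?_
  rw [smul_finsum]
  refine finsum_congr fun i => ?_
  have e : i + j + 1 = j + 1 + i := by ring
  have e1 : (((-1 : ℤ) ^ i : ℤ) : ℂ) = (-1) ^ i := by push_cast; rfl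
  rw [← vmode_vac, smul_smul, e1, ← pow_add, e, Nat.cast_add]
  rfl

theorem mem_grade_of_weight (k : ℤ) (x : V) (hx : vmode 1 omega x = (k : ℂ) • x) :
    x ∈ grade (V := V) k := by
  obtain ⟨y, rfl⟩ := (isInternal (V := V)).2 x
  let f : DirectSum ℤ (fun n => grade (V := V) n) →ₗ[ℂ] DirectSum ℤ (fun n => grade (V := V) n) :=
    DirectSum.lmap (fun n => ((n : ℂ) - k) • LinearMap.id)
  have hf : DirectSum.coeLinearMap (grade (V := V)) ∘ₗ f =
      (vmode 1 omega - (k : ℂ) • LinearMap.id) ∘ₗ DirectSum.coeLinearMap (grade (V := V)) := by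
    refine DirectSum.linearMap_ext _ fun n => ?_
    ext a
    have : vmode 1 omega (a : V) = (n : ℂ) • (a : V) := weight n (a : V) a.2
    simp [f, DirectSum.lmap_lof, this, sub_smul]
  have h1 := congrArg (fun g => g y) hf
  have h2 : (DirectSum.coeLinearMap (grade (V := V))) (f y) = 0 := by
    simp only [LinearMap.comp_apply, LinearMap.sub_apply, LinearMap.smul_apply,
      LinearMap.id_apply] at h1
    rw [h1, sub_eq_zero]
    exact hx
  have h3 : f y = 0 := (isInternal (V := V)).1 (h2.trans (map_zero _).symm)
  have h4 : ∀ n, n ≠ k → y n = 0 := by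
    intro n hn
    have := congrArg (fun g => g n) h3
    simp only [f, DirectSum.lmap_apply, LinearMap.smul_apply, LinearMap.id_apply] at this
    have hne : (n : ℂ) - k ≠ 0 := sub_ne_zero.2 (by exact_mod_cast hn)
    exact (smul_eq_zero.1 this).resolve_left hne
  have h5 : y = DirectSum.lof ℂ ℤ (fun n => grade (V := V) n) k (y k) := by
    ext n
    by_cases hn : n = k
    · subst hn
      simp
    · rw [h4 n hn, DirectSum.lof_eq_of, DirectSum.of_eq_of_ne _ _ _ hn]
  change DirectSum.coeAddMonoidHom _ y ∈ _
  rw [h5, DirectSum.lof_eq_of, DirectSum.coeAddMonoidHom_of]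
  exact (y k).2

theorem vmode_mem (k l n : ℤ) (a b : V) (ha : a ∈ grade k) (hb : b ∈ grade l) :
    vmode n a b ∈ grade (V := V) (k + l - n - 1) := by
  have h := vmode_commutator (V := V) omega a 1 n b
  have hsum : (∑ᶠ k' : ℕ, ((Ring.choose (1 : ℤ) k' : ℤ) : ℂ) •
      vmode (1 + n - k') (vmode (k' : ℤ) omega a) b) =
      vmode (1 + n) (vmode 0 omega a) b + vmode n (vmode 1 omega a) b := by
    rw [finsum_eq_sum_of_support_subset (s := {0, 1})]
    · simp
    · intro i hi
      by_contra hc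
      apply hi
      simp only [Finset.coe_insert, Finset.coe_singleton, Set.mem_insert_iff,
        Set.mem_singleton_iff, not_or] at hc
      have : Ring.choose (1 : ℤ) i = 0 := by
        have := Ring.choose_natCast (R := ℤ) 1 i
        rw [Nat.choose_eq_zero_of_lt (by lia)] at this
        simpa using this
      simp [this]
  have h0 : vmode (1 + n) (vmode 0 omega a) b = (-((1 + n : ℤ) : ℂ)) • vmode n a b := by
    have := congrArg (fun f : Module.End ℂ V => f b) (vmode_translation a (1 + n))
    simpa [vL] using this
  have h1 : vmode 1 omega a = (k : ℂ) • a := weight k a ha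
  have h2 : vmode 1 omega b = (l : ℂ) • b := weight l b hb
  rw [hsum, h0, h1, h2] at h
  apply mem_grade_of_weight
  simp only [map_smul, LinearMap.smul_apply] at h
  rw [sub_eq_iff_eq_add] at h
  rw [h]
  push_cast
  module

end VOA

/-! ### The Lie algebra of a vertex operator algebra and a ring of functions -/

section CurrentLie

variable {V : Type*} [AddCommGroup V] [Module ℂ V] [VertexOperatorAlgebra V]
variable {R : Type*} [CommRing R] [Algebra ℂ R] (D : Derivation ℂ R R)

/-- The operation `(a ⊗ f, b ⊗ g) ↦ a(j) b ⊗ (D^j f / j!) g`. -/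
def bracketTerm (V : Type*) [AddCommGroup V] [Module ℂ V] [VertexOperatorAlgebra V] (j : ℕ) :
    V ⊗[ℂ] R →ₗ[ℂ] V ⊗[ℂ] R →ₗ[ℂ] V ⊗[ℂ] R :=
  TensorProduct.map₂ (vmode (j : ℤ)) (LinearMap.mul ℂ R ∘ₗ divPow D j)

theorem bracketTerm_tmul (j : ℕ) (a b : V) (f g : R) :
    bracketTerm D V j (a ⊗ₜ f) (b ⊗ₜ g) = vmode (j : ℤ) a b ⊗ₜ (divPow D j f * g) := rfl

theorem bracketTerm_bound (x y : V ⊗[ℂ] R) : ∃ N : ℕ, ∀ j, N ≤ j → bracketTerm D V j x y = 0 := by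
  induction x using TensorProduct.induction_on with
  | zero => exact ⟨0, by simp⟩
  | add x x' hx hx' =>
    obtain ⟨N, hN⟩ := hx
    obtain ⟨N', hN'⟩ := hx'
    refine ⟨max N N', fun j hj => ?_⟩
    rw [map_add, LinearMap.add_apply, hN j (le_trans (le_max_left _ _) hj),
      hN' j (le_trans (le_max_right _ _) hj), add_zero]
  | tmul a f =>
    induction y using TensorProduct.induction_on with
    | zero => exact ⟨0, by simp⟩
    | add x x' hx hx' =>
      obtain ⟨N, hN⟩ := hx
      obtain ⟨N', hN'⟩ := hx'
      refine ⟨max N N', fun j hj => ?_⟩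
      rw [map_add, hN j (le_trans (le_max_left _ _) hj),
        hN' j (le_trans (le_max_right _ _) hj), add_zero]
    | tmul b g =>
      obtain ⟨N, hN⟩ := vmode_truncated a b
      refine ⟨N.toNat, fun j hj => ?_⟩
      rw [bracketTerm_tmul, hN j (by lia), TensorProduct.zero_tmul]

theorem finite_of_bound {E : Type*} [AddCommMonoid E] (φ : ℕ → E) (N : ℕ)
    (h : ∀ j, N ≤ j → φ j = 0) : Function.HasFiniteSupport φ :=
  (Set.finite_Iio N).subset fun j hj => by
    by_contra hc
    exact hj (h j (by simpa using hc))

theorem bracketTerm_finite (x y : V ⊗[ℂ] R) :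
    Function.HasFiniteSupport (fun j => bracketTerm D V j x y) := by
  obtain ⟨N, hN⟩ := bracketTerm_bound D x y
  exact finite_of_bound _ N hN

/-- The bilinear operation `(a ⊗ f, b ⊗ g) ↦ ∑ a(j) b ⊗ (D^j f / j!) g`. -/
def preBracket (V : Type*) [AddCommGroup V] [Module ℂ V] [VertexOperatorAlgebra V] :
    V ⊗[ℂ] R →ₗ[ℂ] V ⊗[ℂ] R →ₗ[ℂ] V ⊗[ℂ] R :=
  LinearMap.mk₂ ℂ (fun x y => ∑ᶠ j : ℕ, bracketTerm D V j x y)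
    (fun x x' y => by
      rw [← finsum_add_distrib (bracketTerm_finite D _ _) (bracketTerm_finite D _ _)]
      simp)
    (fun c x y => by
      rw [smul_finsum]
      simp)
    (fun x y y' => by
      rw [← finsum_add_distrib (bracketTerm_finite D _ _) (bracketTerm_finite D _ _)]
      simp)
    (fun c x y => by
      rw [smul_finsum]
      simp)

theorem preBracket_tmul (a b : V) (f g : R) : preBracket D V (a ⊗ₜ f) (b ⊗ₜ g) =
    ∑ᶠ j : ℕ, vmode (j : ℤ) a b ⊗ₜ (divPow D j f * g) := rfl

theorem nabla_tmul (a : V) (f : R) :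
    nabla (vL V (-1)) D (a ⊗ₜ f) = vL V (-1) a ⊗ₜ f + a ⊗ₜ D f := rfl

theorem tmul_finite (a b : V) (F : ℕ → R) :
    Function.HasFiniteSupport (fun j : ℕ => vmode (j : ℤ) a b ⊗ₜ[ℂ] F j) := by
  obtain ⟨N, hN⟩ := vmode_truncated a b
  exact finite_of_bound _ N.toNat fun j hj => by rw [hN j (by lia), TensorProduct.zero_tmul]

theorem finsum_nat_succ {E : Type*} [AddCommMonoid E] (φ : ℕ → E)
    (h : Function.HasFiniteSupport φ) : ∑ᶠ i, φ i = φ 0 + ∑ᶠ i, φ (i + 1) := by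
  obtain ⟨N, hN⟩ := (Set.Finite.bddAbove h)
  have h1 : Function.support φ ⊆ ↑(Finset.range (N + 2)) := fun i hi => by
    have := hN hi
    simp only [Finset.coe_range, Set.mem_Iio]
    lia
  have h2 : Function.support (fun i => φ (i + 1)) ⊆ ↑(Finset.range (N + 1)) := fun i hi => by
    have := hN (show i + 1 ∈ Function.support φ from hi)
    simp only [Finset.coe_range, Set.mem_Iio]
    lia
  rw [finsum_eq_sum_of_support_subset _ h1, finsum_eq_sum_of_support_subset _ h2,
    Finset.sum_range_succ', add_comm]

theorem preBracket_nabla_left (x y : V ⊗[ℂ] R) :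
    preBracket D V (nabla (vL V (-1)) D x) y = 0 := by
  induction x using TensorProduct.induction_on with
  | zero => simp
  | add x x' hx hx' => rw [map_add, map_add, LinearMap.add_apply, hx, hx', add_zero]
  | tmul a f =>
    induction y using TensorProduct.induction_on with
    | zero => simp
    | add x x' hx hx' => rw [map_add, hx, hx', add_zero]
    | tmul b g =>
      rw [nabla_tmul, map_add, LinearMap.add_apply, preBracket_tmul, preBracket_tmul,
        finsum_nat_succ _ (tmul_finite _ _ _)]
      have h0 : vmode ((0 : ℕ) : ℤ) (vL V (-1) a) = 0 := by simp [vmode_translation]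
      have e1 := tmul_finite (vL V (-1) a) b (fun j => divPow D j f * g)
      have e2 : Function.HasFiniteSupport (fun i : ℕ =>
          vmode ((i + 1 : ℕ) : ℤ) (vL V (-1) a) b ⊗ₜ[ℂ] (divPow D (i + 1) f * g)) :=
        Function.HasFiniteSupport.comp_of_injective (g := fun i : ℕ => i + 1)
          (add_left_injective 1) e1
      rw [h0, LinearMap.zero_apply, TensorProduct.zero_tmul, zero_add,
        ← finsum_add_distrib e2 (tmul_finite _ _ _), ← finsum_zero (α := ℕ)]
      refine finsum_congr fun j => ?_
      have : (((j + 1 : ℕ) : ℤ) - 1) = (j : ℤ) := by push_cast; ring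
      rw [vmode_translation, ← divPow_succ', LinearMap.smul_apply, smul_mul_assoc,
        TensorProduct.tmul_smul, ← TensorProduct.smul_tmul', this, ← add_smul]
      push_cast
      simp

theorem tmul_sum (a b : V) (N : ℕ) (hN : ∀ j : ℕ, N ≤ j → vmode (j : ℤ) a b = 0) (F : ℕ → R) :
    ∑ᶠ j : ℕ, vmode (j : ℤ) a b ⊗ₜ[ℂ] F j =
      ∑ j ∈ Finset.range N, vmode (j : ℤ) a b ⊗ₜ[ℂ] F j := by
  apply finsum_eq_sum_of_support_subset
  intro j hj
  by_contra hc
  exact hj (by simp only [hN j (by simpa using hc), TensorProduct.zero_tmul])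

theorem preBracket_nabla_right (x y : V ⊗[ℂ] R) :
    preBracket D V x (nabla (vL V (-1)) D y) = nabla (vL V (-1)) D (preBracket D V x y) := by
  rw [← sub_eq_zero, ← neg_eq_zero, neg_sub, ← preBracket_nabla_left D x y]
  induction x using TensorProduct.induction_on with
  | zero => simp
  | add x x' hx hx' =>
    simp only [map_add, LinearMap.add_apply] at hx hx' ⊢
    rw [← hx, ← hx']
    abel
  | tmul a f =>
    induction y using TensorProduct.induction_on with
    | zero => simp
    | add x x' hx hx' =>
      simp only [map_add] at hx hx' ⊢
      rw [← hx, ← hx']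
      abel
    | tmul b g =>
      obtain ⟨N₁, h₁⟩ := vmode_truncated a b
      obtain ⟨N₂, h₂⟩ := vmode_truncated (vL V (-1) a) b
      obtain ⟨N₃, h₃⟩ := vmode_truncated a (vL V (-1) b)
      obtain ⟨N, k₁, k₂, k₃⟩ : ∃ N : ℕ, N₁ ≤ N ∧ N₂ ≤ N ∧ N₃ ≤ N :=
        ⟨(max N₁ (max N₂ N₃)).toNat, by lia, by lia, by lia⟩
      rw [nabla_tmul, nabla_tmul, map_add, map_add, LinearMap.add_apply, preBracket_tmul,
        preBracket_tmul, preBracket_tmul, preBracket_tmul, preBracket_tmul,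
        tmul_sum a b N (fun j hj => h₁ j (by lia)), tmul_sum a b N (fun j hj => h₁ j (by lia)),
        tmul_sum a b N (fun j hj => h₁ j (by lia)),
        tmul_sum (vL V (-1) a) b N (fun j hj => h₂ j (by lia)),
        tmul_sum a (vL V (-1) b) N (fun j hj => h₃ j (by lia)), map_sum,
        ← Finset.sum_add_distrib, ← Finset.sum_add_distrib, ← Finset.sum_sub_distrib]
      refine Finset.sum_congr rfl fun j _ => ?_
      rw [nabla_tmul, ← translation_commutator, D.leibniz, ← divPow_succ', divPow_succ,
        TensorProduct.tmul_add, TensorProduct.sub_tmul, smul_eq_mul, smul_eq_mul, mul_comm g]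
      abel

/-- The expansion coefficients of `f(z + x) = ∑ (D^p f / p!) xᵖ`. -/
def taylorCoeff (f : R) (p : ℤ) : R := if 0 ≤ p then divPow D p.toNat f else 0

theorem finsum_int_eq_nat {E : Type*} [AddCommMonoid E] (φ : ℤ → E) (h : ∀ n < 0, φ n = 0) :
    ∑ᶠ n : ℤ, φ n = ∑ᶠ n : ℕ, φ n := by
  rw [← finsum_mem_range (f := φ) (g := fun n : ℕ => (n : ℤ)) Nat.cast_injective,
    ← finsum_mem_univ, ← finsum_mem_inter_support, ← finsum_mem_inter_support _ (Set.range _)]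
  congr 1
  ext n
  have : n ∈ Function.support φ → n ∈ Set.range (fun n : ℕ => (n : ℤ)) := fun hn =>
    ⟨n.toNat, Int.toNat_of_nonneg (by
      by_contra hc
      exact hn (h n (by lia)))⟩
  have e : (n ∈ Set.univ ∩ Function.support φ) ↔
      n ∈ Set.range (fun n : ℕ => (n : ℤ)) ∩ Function.support φ := by
    simp only [Set.mem_inter_iff, Set.mem_univ, true_and]
    tauto
  simp only [e]

theorem preBracket_taylor (a b : V) (f g : R) : preBracket D V (a ⊗ₜ f) (b ⊗ₜ g) =
    ∑ᶠ p : ℤ, vmode p a b ⊗ₜ (taylorCoeff D f p * g) := by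
  rw [preBracket_tmul, finsum_int_eq_nat]
  · simp [taylorCoeff]
  · intro n hn
    simp [taylorCoeff, not_le.2 hn]

theorem taylorCoeff_of_neg (f : R) (p : ℤ) (hp : p < 0) : taylorCoeff D f p = 0 := by
  simp [taylorCoeff, not_le.2 hp]

theorem taylorCoeff_mul (f g : R) (k : ℕ) (r : ℤ) : taylorCoeff D (divPow D k f * g) r =
    ∑ᶠ p : ℤ, ((Ring.choose p k : ℤ) : ℂ) • (taylorCoeff D f p * taylorCoeff D g (r + k - p)) := by
  have hsmall : ∀ p : ℤ, 0 ≤ p → p < k → Ring.choose p k = 0 := by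
    intro p h0 hp
    lift p to ℕ using h0
    rw [Ring.choose_natCast, Nat.choose_eq_zero_of_lt (by lia)]
    simp
  have hz : ∀ p : ℤ, p < k ∨ r + k < p →
      ((Ring.choose p k : ℤ) : ℂ) • (taylorCoeff D f p * taylorCoeff D g (r + k - p)) = 0 := by
    rintro p (hp | hp)
    · by_cases h0 : 0 ≤ p
      · simp [hsmall p h0 hp]
      · simp [taylorCoeff_of_neg D f p (by lia)]
    · simp [taylorCoeff_of_neg D g (r + k - p) (by lia)]
  by_cases hr : 0 ≤ r
  · lift r to ℕ using hr
    rw [finsum_eq_sum_of_support_subset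
      (s := (Finset.HasAntidiagonal.antidiagonal r).image (fun ij => ((ij.1 + k : ℕ) : ℤ)))]
    · rw [Finset.sum_image]
      · simp only [taylorCoeff, Nat.cast_nonneg, if_true, Int.toNat_natCast, divPow_mul]
        refine Finset.sum_congr rfl fun ij hij => ?_
        rw [Finset.HasAntidiagonal.mem_antidiagonal] at hij
        have e : (r : ℤ) + k - ((ij.1 + k : ℕ) : ℤ) = (ij.2 : ℤ) := by
          rw [← hij]
          push_cast
          ring
        rw [e, divPow_comp, Ring.choose_natCast]
        simp only [Nat.cast_nonneg, if_true, Int.toNat_natCast]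
        rw [Nat.choose_symm_add, smul_mul_assoc, ← Nat.cast_smul_eq_nsmul ℂ]
        simp
      · rintro ⟨i, j⟩ hij ⟨i', j'⟩ hij' h
        simp only [Finset.mem_coe, Finset.HasAntidiagonal.mem_antidiagonal] at hij hij' h
        ext
        · simp only
          lia
        · simp only
          lia
    · intro p hp
      have h1 : ¬ (p < k ∨ (r : ℤ) + k < p) := fun hc => hp (hz p hc)
      simp only [Finset.coe_image, Set.mem_image, Finset.mem_coe,
        Finset.HasAntidiagonal.mem_antidiagonal]
      exact ⟨((p - k).toNat, (r + k - p).toNat), by simp only; lia, by simp only; lia⟩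
  · rw [taylorCoeff_of_neg D _ r (by lia), finsum_eq_zero_of_forall_eq_zero]
    intro p
    apply hz
    lia

theorem preBracket_jacobi (x y w : V ⊗[ℂ] R) :
    preBracket D V x (preBracket D V y w) - preBracket D V y (preBracket D V x w) =
      preBracket D V (preBracket D V x y) w := by
  induction x using TensorProduct.induction_on with
  | zero => simp
  | add x x' hx hx' =>
    simp only [map_add, LinearMap.add_apply] at hx hx' ⊢
    rw [← hx, ← hx']
    abel
  | tmul a f =>
  induction y using TensorProduct.induction_on with
  | zero => simp
  | add x x' hx hx' =>
    simp only [map_add, LinearMap.add_apply] at hx hx' ⊢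
    rw [← hx, ← hx']
    abel
  | tmul b g =>
  induction w using TensorProduct.induction_on with
  | zero => simp
  | add x x' hx hx' =>
    simp only [map_add] at hx hx' ⊢
    rw [← hx, ← hx']
    abel
  | tmul c h =>
  have key := commutator_expand (vmode_truncated (V := V)) vmode_truncated vmode_commutator
    ((TensorProduct.mk ℂ V R).compl₂ (LinearMap.mulRight ℂ h)) a b c (taylorCoeff D f)
    (taylorCoeff D g) 0 0 (taylorCoeff_of_neg D f) (taylorCoeff_of_neg D g)
  simp only [LinearMap.compl₂_apply, TensorProduct.mk_apply, LinearMap.mulRight_apply] at key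
  have fin : ∀ (a b : V) (f g : R), Function.HasFiniteSupport
      (fun p : ℤ => vmode p a b ⊗ₜ[ℂ] (taylorCoeff D f p * g)) := by
    intro a b f g
    obtain ⟨N, hN⟩ := vmode_truncated a b
    refine finsum_finite_of_bdd _ 0 N ?_
    rintro p (hp | hp)
    · simp [taylorCoeff_of_neg D f p hp]
    · simp [hN p hp]
  have h1 : ∀ (a b : V) (f g : R), preBracket D V (a ⊗ₜ f) (preBracket D V (b ⊗ₜ g) (c ⊗ₜ h)) =
      ∑ᶠ q : ℤ, ∑ᶠ p : ℤ, vmode p a (vmode q b c) ⊗ₜ[ℂ]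
        (taylorCoeff D f p * taylorCoeff D g q * h) := by
    intro a b f g
    rw [preBracket_taylor D b c, map_finsum _ (fin _ _ _ _)]
    refine finsum_congr fun q => ?_
    rw [preBracket_taylor]
    refine finsum_congr fun p => ?_
    rw [mul_assoc]
  rw [h1, h1]
  have h2 : ∀ p q : ℤ, taylorCoeff D g q * taylorCoeff D f p =
      taylorCoeff D f p * taylorCoeff D g q := fun p q => mul_comm _ _
  simp only [h2]
  rw [key, preBracket_tmul D a b, ← LinearMap.flip_apply, map_finsum _ (tmul_finite _ _ _)]
  refine finsum_congr fun k => ?_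
  rw [LinearMap.flip_apply, preBracket_taylor]
  refine finsum_congr fun r => ?_
  rw [taylorCoeff_mul]

theorem mk_translation {V : Type*} [AddCommGroup V] [Module ℂ V] (T : Module.End ℂ V) (i : ℕ) (x : V) (f : R) :
    (LinearMap.range (nabla T D)).mkQ ((((i.factorial : ℂ)⁻¹ • T ^ i) x) ⊗ₜ f) =
      (-1 : ℂ) ^ i • (LinearMap.range (nabla T D)).mkQ (x ⊗ₜ divPow D i f) := by
  have h1 : ∀ (x : V) (f : R), (LinearMap.range (nabla T D)).mkQ (T x ⊗ₜ f) =
      -(LinearMap.range (nabla T D)).mkQ (x ⊗ₜ D f) := by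
    intro x f
    rw [eq_neg_iff_add_eq_zero, ← map_add, Submodule.mkQ_apply, Submodule.Quotient.mk_eq_zero]
    exact ⟨x ⊗ₜ f, rfl⟩
  have h2 : ∀ (i : ℕ) (x : V) (f : R), (LinearMap.range (nabla T D)).mkQ ((T ^ i) x ⊗ₜ f) =
      (-1 : ℂ) ^ i • (LinearMap.range (nabla T D)).mkQ (x ⊗ₜ ((D : R →ₗ[ℂ] R) ^ i) f) := by
    intro i
    induction i with
    | zero => simp
    | succ i ih =>
      intro x f
      rw [pow_succ, Module.End.mul_apply, ih, h1, pow_succ' (D : R →ₗ[ℂ] R), Module.End.mul_apply,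
        pow_succ]
      simp
  rw [LinearMap.smul_apply, ← TensorProduct.smul_tmul', map_smul, h2, divPow, LinearMap.smul_apply,
    TensorProduct.tmul_smul, map_smul, smul_comm]

theorem preBracket_skew (x y : V ⊗[ℂ] R) :
    preBracket D V x y + preBracket D V y x ∈ LinearMap.range (nabla (vL V (-1)) D) := by
  induction x using TensorProduct.induction_on with
  | zero => simp
  | add x x' hx hx' =>
    have := add_mem hx hx'
    simp only [map_add, LinearMap.add_apply]
    convert this using 1
    abel
  | tmul a f =>
  induction y using TensorProduct.induction_on with
  | zero => simp
  | add x x' hx hx' =>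
    have := add_mem hx hx'
    simp only [map_add, LinearMap.add_apply]
    convert this using 1
    abel
  | tmul b g =>
  rw [← Submodule.Quotient.mk_eq_zero, ← Submodule.mkQ_apply]
  set π := (LinearMap.range (nabla (vL V (-1)) D)).mkQ with hπ
  obtain ⟨N₁, h₁⟩ := vmode_truncated a b
  obtain ⟨N₂, h₂⟩ := vmode_truncated b a
  obtain ⟨N, k₁, k₂⟩ : ∃ N : ℕ, N₁ ≤ N ∧ N₂ ≤ N := ⟨(max N₁ N₂).toNat, by lia, by lia⟩
  rw [preBracket_tmul, preBracket_tmul, tmul_sum a b N (fun j hj => h₁ j (by lia)),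
    tmul_sum b a N (fun j hj => h₂ j (by lia)), map_add, map_sum, map_sum]
  have hskew : ∀ j ∈ Finset.range N, π (vmode (j : ℤ) b a ⊗ₜ (divPow D j g * f)) =
      ∑ i ∈ Finset.range (N - j), -((-1 : ℂ) ^ j • π (vmode ((j + i : ℕ) : ℤ) a b ⊗ₜ
        divPow D i (f * divPow D j g))) := by
    intro j _
    rw [vmode_skew, finsum_eq_sum_of_support_subset (s := Finset.range (N - j)),
      TensorProduct.sum_tmul, map_sum]
    · refine Finset.sum_congr rfl fun i _ => ?_
      rw [← TensorProduct.smul_tmul', map_smul, hπ, mk_translation, smul_smul, mul_comm f, ← neg_smul]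
      congr 1
      rw [← pow_add]
      have : i + j + 1 + i = 2 * i + j + 1 := by ring
      rw [this, pow_succ, pow_add, pow_mul]
      simp
    · intro i hi
      by_contra hc
      simp only [Finset.coe_range, Set.mem_Iio, not_lt] at hc
      exact hi (by simp only [h₁ ((j + i : ℕ) : ℤ) (by lia), map_zero, smul_zero])
  rw [Finset.sum_congr rfl hskew, ← Finset.sum_range_diag_flip N (fun j i =>
    -((-1 : ℂ) ^ j • π (vmode ((j + i : ℕ) : ℤ) a b ⊗ₜ divPow D i (f * divPow D j g)))),
    ← Finset.sum_add_distrib]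
  refine Finset.sum_eq_zero fun l _ => ?_
  rw [← divPow_mul_alt D l f g, ← Finset.Nat.sum_antidiagonal_eq_sum_range_succ (fun j i =>
    -((-1 : ℂ) ^ j • π (vmode ((j + i : ℕ) : ℤ) a b ⊗ₜ divPow D i (f * divPow D j g)))),
    ← Finset.Nat.sum_antidiagonal_swap, TensorProduct.tmul_sum, map_sum, ← Finset.sum_add_distrib]
  refine Finset.sum_eq_zero fun ij hij => ?_
  rw [Finset.HasAntidiagonal.mem_antidiagonal] at hij
  simp only [Prod.fst_swap, Prod.snd_swap, TensorProduct.tmul_smul, map_smul]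
  rw [hij, add_neg_cancel]

end CurrentLie

section CurrentLie

variable (V : Type*) [AddCommGroup V] [Module ℂ V] [VertexOperatorAlgebra V] (q : ℂ[X])

/-- The quotient of `V ⊗ ℂ[z][1/q]` by the image of `∇ = L(-1) ⊗ 1 + 1 ⊗ d/dz`. -/
def CurrentLie : Type _ :=
  (V ⊗[ℂ] LocPoly q) ⧸ LinearMap.range (nabla (vL V (-1)) (ddz q))

instance : AddCommGroup (CurrentLie V q) :=
  inferInstanceAs (AddCommGroup ((V ⊗[ℂ] LocPoly q) ⧸ LinearMap.range (nabla (vL V (-1)) (ddz q))))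

instance : Module ℂ (CurrentLie V q) :=
  inferInstanceAs (Module ℂ ((V ⊗[ℂ] LocPoly q) ⧸ LinearMap.range (nabla (vL V (-1)) (ddz q))))

namespace CurrentLie

/-- The projection from `V ⊗ ℂ[z][1/q]`. -/
def mk : V ⊗[ℂ] LocPoly q →ₗ[ℂ] CurrentLie V q :=
  (LinearMap.range (nabla (vL V (-1)) (ddz q))).mkQ

theorem mk_surjective : Function.Surjective (mk V q) := Submodule.mkQ_surjective _

theorem mk_eq_zero (x : V ⊗[ℂ] LocPoly q) :
    mk V q x = 0 ↔ x ∈ LinearMap.range (nabla (vL V (-1)) (ddz q)) :=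
  Submodule.Quotient.mk_eq_zero _

/-- Descent of a linear map that vanishes on the image of `∇`. -/
def lift {E : Type*} [AddCommGroup E] [Module ℂ E] (f : V ⊗[ℂ] LocPoly q →ₗ[ℂ] E)
    (h : ∀ x, f (nabla (vL V (-1)) (ddz q) x) = 0) : CurrentLie V q →ₗ[ℂ] E :=
  (LinearMap.range (nabla (vL V (-1)) (ddz q))).liftQ f (by
    rintro _ ⟨x, rfl⟩
    exact h x)

variable {V q}

theorem lift_mk {E : Type*} [AddCommGroup E] [Module ℂ E] (f : V ⊗[ℂ] LocPoly q →ₗ[ℂ] E)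
    (h : ∀ x, f (nabla (vL V (-1)) (ddz q) x) = 0) (x : V ⊗[ℂ] LocPoly q) :
    lift V q f h (mk V q x) = f x := rfl

/-- The Lie bracket, as a bilinear map:
`[a ⊗ f, b ⊗ g] = ∑ a(j) b ⊗ (1/j!) (d/dz)^j f · g`. -/
def bracketMap : CurrentLie V q →ₗ[ℂ] CurrentLie V q →ₗ[ℂ] CurrentLie V q :=
  lift V q
    { toFun := fun x => lift V q (mk V q ∘ₗ preBracket (ddz q) V x) (fun y => by
        rw [LinearMap.comp_apply, preBracket_nabla_right, mk_eq_zero]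
        exact ⟨_, rfl⟩)
      map_add' := fun x x' => by
        ext y
        obtain ⟨y, rfl⟩ := mk_surjective V q y
        simp [lift_mk]
      map_smul' := fun c x => by
        ext y
        obtain ⟨y, rfl⟩ := mk_surjective V q y
        simp [lift_mk] }
    (fun x => by
      ext y
      obtain ⟨y, rfl⟩ := mk_surjective V q y
      simp [lift_mk, preBracket_nabla_left])

theorem bracketMap_mk (x y : V ⊗[ℂ] LocPoly q) :
    bracketMap (mk V q x) (mk V q y) = mk V q (preBracket (ddz q) V x y) := rfl

instance : Bracket (CurrentLie V q) (CurrentLie V q) := ⟨fun x y => bracketMap x y⟩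

theorem mk_lie (x y : V ⊗[ℂ] LocPoly q) :
    ⁅mk V q x, mk V q y⁆ = mk V q (preBracket (ddz q) V x y) := rfl

instance : LieRing (CurrentLie V q) where
  add_lie x y z := by
    change bracketMap (x + y) z = bracketMap x z + bracketMap y z
    rw [map_add, LinearMap.add_apply]
  lie_add x y z := map_add (bracketMap x) y z
  lie_self x := by
    obtain ⟨x, rfl⟩ := mk_surjective V q x
    rw [mk_lie, mk_eq_zero]
    have h := preBracket_skew (ddz q) x x
    rw [← two_smul ℂ] at h
    exact (Submodule.smul_mem_iff _ two_ne_zero).1 h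
  leibniz_lie x y z := by
    obtain ⟨x, rfl⟩ := mk_surjective V q x
    obtain ⟨y, rfl⟩ := mk_surjective V q y
    obtain ⟨z, rfl⟩ := mk_surjective V q z
    simp only [mk_lie]
    rw [← map_add, ← preBracket_jacobi, sub_add_cancel]

instance : LieAlgebra ℂ (CurrentLie V q) where
  lie_smul c x y := map_smul (bracketMap x) c y

end CurrentLie

/-- The Borcherds Lie algebra `L(V)`. -/
abbrev BorcherdsLie : Type _ := CurrentLie V Polynomial.X

/-- The chiral Lie algebra of `V` and the projective line with the marked points `∞, 1, 0`. -/
abbrev ChiralLie : Type _ := CurrentLie V (Polynomial.X * (Polynomial.X - 1))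

variable {V}

/-- The element `a_[n]` of the Borcherds Lie algebra. -/
def borcherdsElt (a : V) (n : ℤ) : BorcherdsLie V := CurrentLie.mk V _ (a ⊗ₜ laurentFn n)

/-- The element `a ⊗ zⁿ / (z - 1)ᵐ` of the chiral Lie algebra. -/
def chiralElt (a : V) (n m : ℤ) : ChiralLie V := CurrentLie.mk V _ (a ⊗ₜ chiralFn n m)

/-! ### Degrees -/

variable (V)

open VertexOperatorAlgebra

/-- The span of all `a ⊗ zⁿ / (z - 1)ᵐ` with `n - m ≤ wt a - 1 - d`. -/
def chiralFil (d : ℤ) : Submodule ℂ (ChiralLie V) :=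
  Submodule.span ℂ {x | ∃ k : ℤ, ∃ a ∈ grade (V := V) k, ∃ n m : ℤ,
    n - m ≤ k - 1 - d ∧ x = chiralElt a n m}

theorem divPow_chiralFn (j : ℕ) (n m : ℤ) : divPow (ddz _) j (chiralFn n m) ∈
    Submodule.span ℂ {f | ∃ n' m' : ℤ, n' - m' = n - m - j ∧ f = chiralFn n' m'} := by
  induction j with
  | zero =>
    rw [divPow_zero]
    exact Submodule.subset_span ⟨n, m, by simp, rfl⟩
  | succ j ih =>
    have hj : ((j : ℂ) + 1) ≠ 0 := by exact_mod_cast j.succ_ne_zero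
    rw [← Submodule.smul_mem_iff _ hj, divPow_succ]
    have : ∀ f ∈ Submodule.span ℂ {f | ∃ n' m' : ℤ, n' - m' = n - m - j ∧ f = chiralFn n' m'},
        ddz _ f ∈ Submodule.span ℂ {f | ∃ n' m' : ℤ, n' - m' = n - m - ((j + 1 : ℕ) : ℤ) ∧
          f = chiralFn n' m'} := by
      intro f hf
      induction hf using Submodule.span_induction with
      | mem f hf =>
        obtain ⟨n', m', h, rfl⟩ := hf
        rw [ddz_chiralFn]
        refine sub_mem (Submodule.smul_mem _ _ (Submodule.subset_span ⟨_, _, ?_, rfl⟩))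
          (Submodule.smul_mem _ _ (Submodule.subset_span ⟨_, _, ?_, rfl⟩))
        · push_cast
          lia
        · push_cast
          lia
      | zero => simp
      | add f g _ _ hf hg => rw [map_add]; exact add_mem hf hg
      | smul c f _ hf => rw [Derivation.map_smul]; exact Submodule.smul_mem _ _ hf
    exact this _ ih

theorem chiralFil_lie (d e : ℤ) (x y : ChiralLie V) (hx : x ∈ chiralFil V d)
    (hy : y ∈ chiralFil V e) : ⁅x, y⁆ ∈ chiralFil V (d + e) := by
  induction hx using Submodule.span_induction with
  | zero => simp
  | add x x' _ _ hx hx' => rw [add_lie]; exact add_mem hx hx'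
  | smul c x _ hx => rw [smul_lie]; exact Submodule.smul_mem _ _ hx
  | mem x hx =>
  induction hy using Submodule.span_induction with
  | zero => simp
  | add x x' _ _ hx hx' => rw [lie_add]; exact add_mem hx hx'
  | smul c x _ hx => rw [lie_smul]; exact Submodule.smul_mem _ _ hx
  | mem y hy =>
  obtain ⟨k, a, ha, n, m, hnm, rfl⟩ := hx
  obtain ⟨l, b, hb, s, t, hst, rfl⟩ := hy
  rw [chiralElt, chiralElt, CurrentLie.mk_lie, preBracket_tmul, map_finsum _ (tmul_finite _ _ _)]
  refine finsum_induction (p := fun x => x ∈ chiralFil V (d + e)) (zero_mem _)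
    (fun x y => add_mem) fun j => ?_
  have hab := vmode_mem k l j a b ha hb
  have h1 : ∀ f ∈ Submodule.span ℂ {f | ∃ n' m' : ℤ, n' - m' = n - m - j ∧ f = chiralFn n' m'},
      CurrentLie.mk V _ (vmode (j : ℤ) a b ⊗ₜ (f * chiralFn s t)) ∈ chiralFil V (d + e) := by
    intro f hf
    induction hf using Submodule.span_induction with
    | zero => simp
    | add f g _ _ hf hg => rw [add_mul, TensorProduct.tmul_add, map_add]; exact add_mem hf hg
    | smul c f _ hf =>
      rw [smul_mul_assoc, TensorProduct.tmul_smul, map_smul]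
      exact Submodule.smul_mem _ _ hf
    | mem f hf =>
      obtain ⟨n', m', h, rfl⟩ := hf
      rw [chiralFn_mul]
      exact Submodule.subset_span ⟨_, _, hab, _, _, by lia, rfl⟩
  exact h1 _ (divPow_chiralFn j n m)

theorem chiralFil_mono {d e : ℤ} (h : d ≤ e) : chiralFil V e ≤ chiralFil V d := by
  refine Submodule.span_mono ?_
  rintro x ⟨k, a, ha, n, m, hnm, rfl⟩
  exact ⟨k, a, ha, n, m, by lia, rfl⟩

end CurrentLie

section Restricted

variable (V : Type*) [AddCommGroup V] [Module ℂ V] [VertexOperatorAlgebra V]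

open VertexOperatorAlgebra

/-- The `∞`-restricted chiral Lie algebra, spanned by all `a ⊗ zⁿ / (z - 1)ᵐ` with
`n - m ≤ wt a - 1`. -/
def chiralLE : LieSubalgebra ℂ (ChiralLie V) :=
  { chiralFil V 0 with
    lie_mem' := fun {x y} hx hy => by simpa using chiralFil_lie V 0 0 x y hx hy }

theorem mem_chiralLE (x : ChiralLie V) : x ∈ chiralLE V ↔ x ∈ chiralFil V 0 := Iff.rfl

/-- The augmented ideal of the `∞`-restricted chiral Lie algebra, spanned by all
`a ⊗ zⁿ / (z - 1)ᵐ` with `n - m < wt a - 1`, i.e. `n - m ≤ wt a - 1 - 1`. -/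
def chiralLT : LieIdeal ℂ (chiralLE V) :=
  { (chiralFil V 1).comap (chiralLE V).toSubmodule.subtype with
    lie_mem := fun {x y} hy => by
      have := chiralFil_lie V 0 1 x y x.2 hy
      rw [zero_add] at this
      exact this }

theorem mem_chiralLT (x : chiralLE V) : x ∈ chiralLT V ↔ (x : ChiralLie V) ∈ chiralFil V 1 :=
  Iff.rfl

theorem divPow_laurentFn (j : ℕ) (n : ℤ) :
    ∃ c : ℂ, divPow (ddz _) j (laurentFn n) = c • laurentFn (n - j) := by
  induction j with
  | zero => exact ⟨1, by simp [divPow_zero]⟩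
  | succ j ih =>
    obtain ⟨c, hc⟩ := ih
    have hj : ((j : ℂ) + 1) ≠ 0 := by exact_mod_cast j.succ_ne_zero
    refine ⟨((j : ℂ) + 1)⁻¹ * (c * ((n - j : ℤ) : ℂ)), ?_⟩
    apply smul_right_injective _ hj
    simp only
    have e : n - ((j + 1 : ℕ) : ℤ) = n - j - 1 := by push_cast; ring
    rw [divPow_succ, hc, Derivation.map_smul, ddz_laurentFn, smul_smul, smul_smul, ← mul_assoc,
      mul_inv_cancel₀ hj, one_mul, e]

/-- The degree zero part `L(V)_0` of the Borcherds Lie algebra, spanned by all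
`a_[wt a - 1]`. -/
def borcherdsZero : LieSubalgebra ℂ (BorcherdsLie V) :=
  { Submodule.span ℂ {x | ∃ k : ℤ, ∃ a ∈ grade (V := V) k, x = borcherdsElt a (k - 1)} with
    lie_mem' := fun {x y} hx hy => by
      change ⁅x, y⁆ ∈ Submodule.span ℂ _
      change x ∈ Submodule.span ℂ _ at hx
      change y ∈ Submodule.span ℂ _ at hy
      induction hx using Submodule.span_induction with
      | zero => simp
      | add x x' _ _ hx hx' => rw [add_lie]; exact add_mem hx hx'
      | smul c x _ hx => rw [smul_lie]; exact Submodule.smul_mem _ _ hx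
      | mem x hx =>
      induction hy using Submodule.span_induction with
      | zero => simp
      | add x x' _ _ hx hx' => rw [lie_add]; exact add_mem hx hx'
      | smul c x _ hx => rw [lie_smul]; exact Submodule.smul_mem _ _ hx
      | mem y hy =>
      obtain ⟨k, a, ha, rfl⟩ := hx
      obtain ⟨l, b, hb, rfl⟩ := hy
      rw [borcherdsElt, borcherdsElt, CurrentLie.mk_lie, preBracket_tmul,
        map_finsum _ (tmul_finite _ _ _)]
      refine finsum_induction (p := fun x => x ∈ Submodule.span ℂ _) (zero_mem _)
        (fun x y => add_mem) fun j => ?_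
      obtain ⟨c, hc⟩ := divPow_laurentFn j (k - 1)
      rw [hc, smul_mul_assoc, TensorProduct.tmul_smul, map_smul]
      refine Submodule.smul_mem _ _ (Submodule.subset_span ⟨_, _, vmode_mem k l j a b ha hb, ?_⟩)
      rw [borcherdsElt, laurentFn, laurentFn, laurentFn, ← Units.val_mul, ← zpow_add]
      congr 4
      ring }

theorem mem_borcherdsZero (x : BorcherdsLie V) : x ∈ borcherdsZero V ↔
    x ∈ Submodule.span ℂ {x | ∃ k : ℤ, ∃ a ∈ grade (V := V) k, x = borcherdsElt a (k - 1)} :=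
  Iff.rfl

/-- The inclusion of `ℂ[z, z⁻¹]` into `ℂ[z, z⁻¹, (z - 1)⁻¹]`. -/
def laurentIncl : LaurentRing →ₐ[ℂ] ChiralRing :=
  evalAt _ (coord _) (by
    rw [Polynomial.aeval_X]
    exact chiralZ.isUnit)

theorem laurentIncl_ddz (f : LaurentRing) : laurentIncl (ddz _ f) = ddz _ (laurentIncl f) := by
  have := eq_of_leibniz Polynomial.X laurentIncl
    (laurentIncl.toLinearMap.comp (ddz Polynomial.X).toLinearMap).toAddMonoidHom
    ((ddz (Polynomial.X * (Polynomial.X - 1))).toLinearMap.comp laurentIncl.toLinearMap).toAddMonoidHom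
    (by intro f g; simp) (by intro f g; simp) (by intro c; simp) (by intro c; simp)
    (by
      have : laurentIncl (coord _) = coord _ := evalAt_coord _ _ _
      simp [ddz_coord, this])
  exact congrArg (fun k => k f) this

theorem laurentIncl_laurentFn (n : ℤ) : laurentIncl (laurentFn n) = chiralFn n 0 := by
  have h : Units.map (laurentIncl : LaurentRing →* ChiralRing) laurentZ = chiralZ := by
    have : laurentIncl (coord _) = coord _ := evalAt_coord _ _ _
    ext
    exact this
  rw [chiralFn, laurentFn, neg_zero, zpow_zero, mul_one, ← h, ← map_zpow]
  rfl

theorem laurentIncl_divPow (j : ℕ) (f : LaurentRing) :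
    laurentIncl (divPow (ddz _) j f) = divPow (ddz _) j (laurentIncl f) := by
  induction j with
  | zero => simp [divPow_zero]
  | succ j ih =>
    have hj : ((j : ℂ) + 1) ≠ 0 := by exact_mod_cast j.succ_ne_zero
    apply smul_right_injective _ hj
    simp only
    rw [← map_smul, divPow_succ, divPow_succ, laurentIncl_ddz, ih]

/-- The homomorphism `a_[n] ↦ a ⊗ zⁿ` from the Borcherds Lie algebra to the chiral Lie algebra. -/
def borcherdsToChiral : BorcherdsLie V →ₗ⁅ℂ⁆ ChiralLie V :=
  { CurrentLie.lift V _ (CurrentLie.mk V _ ∘ₗ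
      TensorProduct.map LinearMap.id laurentIncl.toLinearMap) (fun x => by
        rw [LinearMap.comp_apply, CurrentLie.mk_eq_zero]
        refine ⟨TensorProduct.map LinearMap.id laurentIncl.toLinearMap x, ?_⟩
        induction x using TensorProduct.induction_on with
        | zero => simp
        | add x y hx hy => rw [map_add, map_add, hx, hy, map_add, map_add]
        | tmul a f => simp [nabla, laurentIncl_ddz]) with
    map_lie' := fun {x y} => by
      obtain ⟨x, rfl⟩ := CurrentLie.mk_surjective V _ x
      obtain ⟨y, rfl⟩ := CurrentLie.mk_surjective V _ y
      change CurrentLie.mk V _ (TensorProduct.map LinearMap.id laurentIncl.toLinearMap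
        (preBracket _ V x y)) = CurrentLie.mk V _ (preBracket _ V _ _)
      congr 1
      induction x using TensorProduct.induction_on with
      | zero => simp
      | add x x' hx hx' => simp only [map_add, LinearMap.add_apply, hx, hx']
      | tmul a f =>
      induction y using TensorProduct.induction_on with
      | zero => simp
      | add x x' hx hx' => simp only [map_add, hx, hx']
      | tmul b g =>
      rw [preBracket_tmul, map_finsum _ (tmul_finite _ _ _), TensorProduct.map_tmul,
        TensorProduct.map_tmul, LinearMap.id_apply, LinearMap.id_apply, preBracket_tmul]
      refine finsum_congr fun j => ?_
      simp [laurentIncl_divPow] }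

theorem borcherdsToChiral_elt (a : V) (n : ℤ) :
    borcherdsToChiral V (borcherdsElt a n) = chiralElt a n 0 := by
  change CurrentLie.mk V _ (a ⊗ₜ laurentIncl (laurentFn n)) = _
  rw [laurentIncl_laurentFn]
  rfl

/-- The homomorphism `a_[wt a - 1] ↦ a ⊗ z^(wt a - 1)` from `L(V)_0` to the `∞`-restricted chiral
Lie algebra. -/
def borcherdsZeroToChiral : borcherdsZero V →ₗ⁅ℂ⁆ chiralLE V where
  toFun x := ⟨borcherdsToChiral V x, by
    have hx := x.2
    rw [mem_borcherdsZero] at hx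
    rw [mem_chiralLE]
    generalize (x : BorcherdsLie V) = y at hx
    induction hx using Submodule.span_induction with
    | zero => simp
    | add x y _ _ hx hy => rw [map_add]; exact add_mem hx hy
    | smul c x _ hx => rw [map_smul]; exact Submodule.smul_mem _ _ hx
    | mem x hx =>
      obtain ⟨k, a, ha, rfl⟩ := hx
      rw [borcherdsToChiral_elt]
      exact Submodule.subset_span ⟨k, a, ha, _, _, by lia, rfl⟩⟩
  map_add' x y := by ext; simp
  map_smul' c x := by ext; simp
  map_lie' {x y} := by ext; simp

/-- The homomorphism `a_[wt a - 1] ↦ [a ⊗ z^(wt a - 1)]` from `L(V)_0` to the quotient of the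
`∞`-restricted chiral Lie algebra by its augmented ideal. -/
def borcherdsZeroToQuotient : borcherdsZero V →ₗ⁅ℂ⁆ chiralLE V ⧸ chiralLT V where
  toFun x := LieSubmodule.Quotient.mk (borcherdsZeroToChiral V x)
  map_add' x y := by rw [map_add]; rfl
  map_smul' c x := by rw [map_smul]; rfl
  map_lie' {x y} := by rw [LieHom.map_lie]; rfl

end Restricted

/-! ### Actions on modules -/

section Actions

attribute [local instance] LieRing.ofAssociativeRing

variable (V : Type*) [AddCommGroup V] [Module ℂ V] [VertexOperatorAlgebra V]
variable (M : Type*) [AddCommGroup M] [Module ℂ M] [AdmissibleModule V M]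

open VertexOperatorAlgebra

/-- The representation `a ⊗ f ↦ Res Y_M(a, x) e(f)` on a module, for an expansion `e` in a local
coordinate `x = z - c`. -/
def residueHom {q : ℂ[X]} (e : LocPoly q →ₐ[ℂ] LaurentSeries ℂ)
    (he : ∀ f n, (e (ddz q f)).coeff n = ((n : ℂ) + 1) * (e f).coeff (n + 1)) :
    CurrentLie V q →ₗ⁅ℂ⁆ Module.End ℂ M :=
  { CurrentLie.lift V q (residueMap (mmode V M) (mmode_truncated M) e)
      (residueMap_nabla (ddz q) (vL V (-1)) (mmode V M) (mmode_truncated M) e he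
        (mmode_translation M)) with
    map_lie' := fun {x y} => by
      obtain ⟨x, rfl⟩ := CurrentLie.mk_surjective V _ x
      obtain ⟨y, rfl⟩ := CurrentLie.mk_surjective V _ y
      change residueMap (mmode V M) (mmode_truncated M) e (preBracket _ V x y) =
        ⁅residueMap (mmode V M) (mmode_truncated M) e x,
          residueMap (mmode V M) (mmode_truncated M) e y⁆
      induction x using TensorProduct.induction_on with
      | zero => simp
      | add x x' hx hx' => simp only [map_add, LinearMap.add_apply, hx, hx', add_lie]
      | tmul a f =>
      induction y using TensorProduct.induction_on with
      | zero => simp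
      | add x x' hx hx' => simp only [map_add, hx, hx', lie_add]
      | tmul b g =>
      ext w
      rw [Ring.lie_def, LinearMap.sub_apply, Module.End.mul_apply, Module.End.mul_apply,
        residueMap_tmul, residueMap_tmul,
        residue_commutator (ddz q) e he vmode_truncated (mmode_truncated M) (mmode_commutator M),
        preBracket_tmul, map_finsum _ (tmul_finite _ _ _), ← LinearMap.applyₗ_apply_apply (R := ℂ), map_finsum]
      · rfl
      · obtain ⟨N, hN⟩ := vmode_truncated a b
        refine finite_of_bound _ N.toNat fun j hj => ?_
        rw [hN j (by lia), TensorProduct.zero_tmul, map_zero] }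

theorem residueHom_mk {q : ℂ[X]} (e : LocPoly q →ₐ[ℂ] LaurentSeries ℂ)
    (he : ∀ f n, (e (ddz q f)).coeff n = ((n : ℂ) + 1) * (e f).coeff (n + 1)) (a : V)
    (f : LocPoly q) (u : M) : residueHom V M e he (CurrentLie.mk V q (a ⊗ₜ f)) u =
      ∑ᶠ n : ℤ, (e f).coeff n • mmode V M n a u := rfl

/-- The action `a_[n] ↦ a(n)` of the Borcherds Lie algebra on a module. -/
def rhoBorcherds : BorcherdsLie V →ₗ⁅ℂ⁆ Module.End ℂ M :=
  residueHom V M laurentExpand laurentExpand_ddz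

/-- The action of the chiral Lie algebra on a module attached to the point `0`. -/
def rhoZero : ChiralLie V →ₗ⁅ℂ⁆ Module.End ℂ M := residueHom V M expandZero expandZero_ddz

/-- The action of the chiral Lie algebra on a module attached to the point `1`. -/
def rhoOne : ChiralLie V →ₗ⁅ℂ⁆ Module.End ℂ M := residueHom V M expandOne expandOne_ddz

theorem rhoBorcherds_elt (a : V) (n : ℤ) : rhoBorcherds V M (borcherdsElt a n) = mmode V M n a := by
  ext u
  have h : laurentExpand (laurentFn n) = HahnSeries.single n 1 := by
    have h1 : Units.map (laurentExpand : LaurentRing →* LaurentSeries ℂ) laurentZ =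
        Units.mk0 (HahnSeries.single 1 1) (by simp) := by
      have : laurentExpand (coord _) = HahnSeries.single 1 1 := evalAt_coord _ _ _
      ext1
      exact this
    have h2 : laurentExpand (laurentFn n) =
        ((Units.map (laurentExpand : LaurentRing →* LaurentSeries ℂ) (laurentZ ^ n) :
          (LaurentSeries ℂ)ˣ) : LaurentSeries ℂ) := rfl
    rw [h2, map_zpow, h1, Units.val_zpow_eq_zpow_val, Units.val_mk0, ← RatFunc.single_zpow]
  rw [rhoBorcherds, borcherdsElt, residueHom_mk, h, finsum_eq_single _ n]
  · simp
  · intro m hm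
    simp [HahnSeries.coeff_single_of_ne hm]

end Actions

section Hom

attribute [local instance] LieRing.ofAssociativeRing

variable (V : Type*) [AddCommGroup V] [Module ℂ V] [VertexOperatorAlgebra V]

/-! ### The bottom level -/

section Bottom

variable (M : Type*) [AddCommGroup M] [Module ℂ M] [AdmissibleModule V M]

/-- The bottom level `M(0)` of an admissible module. -/
def Bottom : Type _ := AdmissibleModule.grade V (M := M) 0

instance : AddCommGroup (Bottom V M) :=
  inferInstanceAs (AddCommGroup (AdmissibleModule.grade V (M := M) 0))

instance : Module ℂ (Bottom V M) :=
  inferInstanceAs (Module ℂ (AdmissibleModule.grade V (M := M) 0))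

/-- The inclusion of the bottom level. -/
def bottomIncl : Bottom V M →ₗ[ℂ] M := (AdmissibleModule.grade V (M := M) 0).subtype

theorem bottomIncl_injective : Function.Injective (bottomIncl V M) := Subtype.val_injective

theorem rhoBorcherds_bottom (x : borcherdsZero V) (u : M) (hu : u ∈ AdmissibleModule.grade V 0) :
    rhoBorcherds V M x u ∈ AdmissibleModule.grade V (M := M) 0 := by
  have hx := x.2
  rw [mem_borcherdsZero] at hx
  generalize (x : BorcherdsLie V) = y at hx
  induction hx using Submodule.span_induction with
  | zero => simp
  | add x y _ _ hx hy => rw [map_add]; exact add_mem hx hy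
  | smul c x _ hx => rw [map_smul]; exact Submodule.smul_mem _ _ hx
  | mem x hx =>
    obtain ⟨k, a, ha, rfl⟩ := hx
    rw [rhoBorcherds_elt, mmode_apply]
    have := AdmissibleModule.mode_mem k a ha (k - 1) 0 u hu
    have e : ((0 : ℕ) : ℤ) + k - (k - 1) - 1 = 0 := by push_cast; ring
    rw [e] at this
    simpa [extendGrade] using this

/-- The action of `L(V)_0` on `M(0)`, under which `a_[wt a - 1]` acts by
`o(a) = a(wt a - 1)`. -/
instance : LieRingModule (borcherdsZero V) (Bottom V M) where
  bracket x u := ⟨rhoBorcherds V M x (bottomIncl V M u), rhoBorcherds_bottom V M x _ u.2⟩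
  add_lie x y u := by
    apply bottomIncl_injective
    change rhoBorcherds V M (x + y : BorcherdsLie V) _ = rhoBorcherds V M x _ + rhoBorcherds V M y _
    rw [map_add, LinearMap.add_apply]
  lie_add x u w := by
    apply bottomIncl_injective
    change rhoBorcherds V M x (bottomIncl V M (u + w)) = rhoBorcherds V M x _ + rhoBorcherds V M x _
    rw [map_add, map_add]
  leibniz_lie x y u := by
    apply bottomIncl_injective
    change rhoBorcherds V M x (rhoBorcherds V M y (bottomIncl V M u)) =
      rhoBorcherds V M (⁅(x : BorcherdsLie V), (y : BorcherdsLie V)⁆) (bottomIncl V M u) +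
      rhoBorcherds V M y (rhoBorcherds V M x (bottomIncl V M u))
    rw [LieHom.map_lie, Ring.lie_def, LinearMap.sub_apply, Module.End.mul_apply,
      Module.End.mul_apply, sub_add_cancel]

theorem bottomIncl_lie (x : borcherdsZero V) (u : Bottom V M) :
    bottomIncl V M ⁅x, u⁆ = rhoBorcherds V M x (bottomIncl V M u) := rfl

instance : LieModule ℂ (borcherdsZero V) (Bottom V M) where
  smul_lie c x u := by
    apply bottomIncl_injective
    rw [map_smul, bottomIncl_lie, bottomIncl_lie]
    change rhoBorcherds V M (c • (x : BorcherdsLie V)) _ = _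
    rw [map_smul, LinearMap.smul_apply]
  lie_smul c x u := by
    apply bottomIncl_injective
    rw [map_smul, bottomIncl_lie, bottomIncl_lie, map_smul, map_smul]

end Bottom

/-! ### The contracted tensor product -/

section Odot

variable (M₁ M₂ : Type*) [AddCommGroup M₁] [Module ℂ M₁] [AdmissibleModule V M₁]
  [AddCommGroup M₂] [Module ℂ M₂] [AdmissibleModule V M₂]

/-- The action of the chiral Lie algebra on `M₁ ⊗ M₂`, with `M₁` attached to the point `1` and `M₂`
to the point `0`. -/
def rhoOneZero : ChiralLie V →ₗ⁅ℂ⁆ Module.End ℂ (M₁ ⊗[ℂ] M₂) where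
  toFun x := TensorProduct.map (rhoOne V M₁ x) LinearMap.id +
    TensorProduct.map LinearMap.id (rhoZero V M₂ x)
  map_add' x y := by
    rw [map_add, map_add, TensorProduct.map_add_left, TensorProduct.map_add_right]
    abel
  map_smul' c x := by
    rw [map_smul, map_smul, TensorProduct.map_smul_left, TensorProduct.map_smul_right,
      RingHom.id_apply, smul_add]
  map_lie' {x y} := by
    ext u w
    simp only [LieHom.map_lie, Ring.lie_def]
    simp [TensorProduct.sub_tmul, TensorProduct.tmul_sub]
    abel

theorem rhoOneZero_tmul (x : ChiralLie V) (u : M₁) (w : M₂) :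
    rhoOneZero V M₁ M₂ x (u ⊗ₜ w) = rhoOne V M₁ x u ⊗ₜ w + u ⊗ₜ rhoZero V M₂ x w := rfl

/-- The subspace of `M₁ ⊗ M₂` spanned by the image of the action of the augmented ideal. -/
def odotKernel : Submodule ℂ (M₁ ⊗[ℂ] M₂) :=
  Submodule.span ℂ {t | ∃ x ∈ chiralLT V, ∃ s, t = rhoOneZero V M₁ M₂ (x : ChiralLie V) s}

theorem odotKernel_stable (x : chiralLE V) (t : M₁ ⊗[ℂ] M₂) (ht : t ∈ odotKernel V M₁ M₂) :
    rhoOneZero V M₁ M₂ x t ∈ odotKernel V M₁ M₂ := by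
  induction ht using Submodule.span_induction with
  | zero => simp
  | add s t _ _ hs ht => rw [map_add]; exact add_mem hs ht
  | smul c t _ ht => rw [map_smul]; exact Submodule.smul_mem _ _ ht
  | mem t ht =>
    obtain ⟨y, hy, s, rfl⟩ := ht
    have h : rhoOneZero V M₁ M₂ x (rhoOneZero V M₁ M₂ y s) =
        rhoOneZero V M₁ M₂ (⁅x, y⁆ : chiralLE V) s +
          rhoOneZero V M₁ M₂ y (rhoOneZero V M₁ M₂ x s) := by
      rw [LieSubalgebra.coe_bracket, LieHom.map_lie, Ring.lie_def, LinearMap.sub_apply,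
        Module.End.mul_apply, Module.End.mul_apply, sub_add_cancel]
    rw [h]
    exact add_mem (Submodule.subset_span ⟨_, lie_mem_right ℂ _ _ _ _ hy, _, rfl⟩)
      (Submodule.subset_span ⟨_, hy, _, rfl⟩)

/-- The contracted tensor product `M₁ ⊙ M₂`, the quotient of `M₁ ⊗ M₂` by the image of the action
of the augmented ideal. -/
def Odot : Type _ := (M₁ ⊗[ℂ] M₂) ⧸ odotKernel V M₁ M₂

instance : AddCommGroup (Odot V M₁ M₂) :=
  inferInstanceAs (AddCommGroup ((M₁ ⊗[ℂ] M₂) ⧸ odotKernel V M₁ M₂))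

instance : Module ℂ (Odot V M₁ M₂) :=
  inferInstanceAs (Module ℂ ((M₁ ⊗[ℂ] M₂) ⧸ odotKernel V M₁ M₂))

/-- The projection from `M₁ ⊗ M₂` to `M₁ ⊙ M₂`. -/
def Odot.mk : M₁ ⊗[ℂ] M₂ →ₗ[ℂ] Odot V M₁ M₂ := (odotKernel V M₁ M₂).mkQ

theorem Odot.mk_surjective : Function.Surjective (Odot.mk V M₁ M₂) := Submodule.mkQ_surjective _

/-- The action of an element of the `∞`-restricted chiral Lie algebra on `M₁ ⊙ M₂`. -/
def odotAction (x : chiralLE V) : Module.End ℂ (Odot V M₁ M₂) :=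
  (odotKernel V M₁ M₂).mapQ (odotKernel V M₁ M₂) (rhoOneZero V M₁ M₂ x)
    (odotKernel_stable V M₁ M₂ x)

theorem odotAction_mk (x : chiralLE V) (t : M₁ ⊗[ℂ] M₂) :
    odotAction V M₁ M₂ x (Odot.mk V M₁ M₂ t) = Odot.mk V M₁ M₂ (rhoOneZero V M₁ M₂ x t) := rfl

/-- The augmented ideal acts by zero, so that the action factors through the quotient of the
`∞`-restricted chiral Lie algebra by its augmented ideal. -/
theorem odotAction_eq_zero (x : chiralLE V) (hx : x ∈ chiralLT V) :
    odotAction V M₁ M₂ x = 0 := by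
  ext t
  obtain ⟨t, rfl⟩ := Odot.mk_surjective V M₁ M₂ t
  rw [odotAction_mk, LinearMap.zero_apply]
  exact (Submodule.Quotient.mk_eq_zero _).2 (Submodule.subset_span ⟨x, hx, t, rfl⟩)

/-- The action of `L(V)_0` on `M₁ ⊙ M₂`, under which `a_[wt a - 1]` acts by the class of
`a ⊗ z^(wt a - 1)`. -/
instance : LieRingModule (borcherdsZero V) (Odot V M₁ M₂) where
  bracket x t := odotAction V M₁ M₂ (borcherdsZeroToChiral V x) t
  add_lie x y t := by
    obtain ⟨t, rfl⟩ := Odot.mk_surjective V M₁ M₂ t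
    rw [map_add (borcherdsZeroToChiral V), odotAction_mk, odotAction_mk, odotAction_mk,
      ← map_add (Odot.mk V M₁ M₂)]
    congr 1
    change rhoOneZero V M₁ M₂ ((borcherdsZeroToChiral V x : ChiralLie V) +
      (borcherdsZeroToChiral V y : ChiralLie V)) t = _
    rw [map_add, LinearMap.add_apply]
  lie_add x s t := map_add _ s t
  leibniz_lie x y t := by
    obtain ⟨t, rfl⟩ := Odot.mk_surjective V M₁ M₂ t
    rw [LieHom.map_lie]
    simp only [odotAction_mk]
    rw [← map_add, LieSubalgebra.coe_bracket, LieHom.map_lie, Ring.lie_def, LinearMap.sub_apply,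
      Module.End.mul_apply, Module.End.mul_apply, sub_add_cancel]

theorem odot_lie_mk (x : borcherdsZero V) (t : M₁ ⊗[ℂ] M₂) : ⁅x, Odot.mk V M₁ M₂ t⁆ =
    Odot.mk V M₁ M₂ (rhoOneZero V M₁ M₂ (borcherdsZeroToChiral V x) t) := rfl

instance : LieModule ℂ (borcherdsZero V) (Odot V M₁ M₂) where
  smul_lie c x t := by
    obtain ⟨t, rfl⟩ := Odot.mk_surjective V M₁ M₂ t
    rw [odot_lie_mk, odot_lie_mk, ← map_smul, map_smul]
    congr 1
    change rhoOneZero V M₁ M₂ (c • (borcherdsZeroToChiral V x : ChiralLie V)) t = _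
    rw [map_smul, LinearMap.smul_apply]
  lie_smul c x t := map_smul (odotAction V M₁ M₂ (borcherdsZeroToChiral V x)) c t

end Odot

end Hom

/-! ### Contragredient modules -/

section Contragredient

open VertexOperatorAlgebra

variable {V : Type*} [AddCommGroup V] [Module ℂ V] [VertexOperatorAlgebra V]

theorem homogeneous_induction {p : V → Prop} (h : ∀ k, ∀ a ∈ grade (V := V) k, p a)
    (hadd : ∀ a b, p a → p b → p (a + b)) (a : V) : p a := by
  have ha : a ∈ ⨆ k, grade (V := V) k := by
    rw [(isInternal (V := V)).submodule_iSup_eq_top]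
    trivial
  induction ha using Submodule.iSup_induction' with
  | mem k a ha => exact h k a ha
  | zero => exact h 0 0 (zero_mem _)
  | add a b _ _ ha hb => exact hadd a b ha hb

theorem module_homogeneous_induction (M : Type*) [AddCommGroup M] [Module ℂ M]
    [AdmissibleModule V M] {p : M → Prop}
    (h : ∀ k, ∀ u ∈ AdmissibleModule.grade V (M := M) k, p u)
    (hadd : ∀ u w, p u → p w → p (u + w)) (u : M) : p u := by
  have hu : u ∈ ⨆ k, AdmissibleModule.grade V (M := M) k := by
    rw [(AdmissibleModule.isInternal (V := V) (M := M)).submodule_iSup_eq_top]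
    trivial
  induction hu using Submodule.iSup_induction' with
  | mem k u hu => exact h k u hu
  | zero => exact h 0 0 (zero_mem _)
  | add u w _ _ hu hw => exact hadd u w hu hw

theorem vL_one_pow_mem (k : ℤ) (a : V) (ha : a ∈ grade k) (j : ℕ) :
    ((vL V 1) ^ j) a ∈ grade (V := V) (k - j) := by
  induction j with
  | zero => simpa using ha
  | succ j ih =>
    rw [pow_succ', Module.End.mul_apply]
    have := vmode_mem 2 (k - j) 2 omega _ omega_mem ih
    have e : 2 + (k - j) - 2 - 1 = k - ((j + 1 : ℕ) : ℤ) := by push_cast; ring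
    rw [e] at this
    exact this

theorem vL_one_pow_eventually_zero (k : ℤ) :
    ∃ N : ℕ, ∀ j, N ≤ j → ∀ a ∈ grade (V := V) k, ((vL V 1) ^ j) a = 0 := by
  obtain ⟨N, hN⟩ := bddBelow (V := V)
  refine ⟨(k - N + 1).toNat, fun j hj a ha => ?_⟩
  have := vL_one_pow_mem k a ha j
  rw [hN _ (by lia)] at this
  simpa using this

/-- The decomposition of `V` into homogeneous subspaces. -/
def gradeEquiv : (DirectSum ℤ fun k => grade (V := V) k) ≃ₗ[ℂ] V :=
  LinearEquiv.ofBijective (DirectSum.coeLinearMap (grade (V := V)))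
    (show Function.Bijective (DirectSum.coeLinearMap (grade (V := V))) from isInternal)

theorem gradeEquiv_symm_apply (k : ℤ) (a : V) (ha : a ∈ grade k) : gradeEquiv.symm a =
    DirectSum.lof ℂ ℤ (fun k => grade (V := V) k) k ⟨a, ha⟩ := by
  rw [LinearEquiv.symm_apply_eq, gradeEquiv, LinearEquiv.ofBijective_apply,
    DirectSum.coeLinearMap_lof]

section Opp

variable {W : Type*} [AddCommGroup W] [Module ℂ W]

/-- The summand of `oppMode` of index `j`, on `V_k`. -/
def oppTerm (φ : ℤ → V →ₗ[ℂ] Module.End ℂ W) (n k : ℤ) (j : ℕ) :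
    grade (V := V) k →ₗ[ℂ] Module.End ℂ W :=
  ((-1 : ℂ) ^ k * (j.factorial : ℂ)⁻¹) •
    (φ (2 * k - n - j - 2) ∘ₗ ((vL V 1) ^ j) ∘ₗ (grade (V := V) k).subtype)

/-- For operators `a(n)` on `W`, the operators
`a'(n) = ∑ (-1)^(wt a) / j! (L(1)^j a)(2 wt a - n - j - 2)`, the sum being over `j ≥ 0`. -/
def oppMode (φ : ℤ → V →ₗ[ℂ] Module.End ℂ W) (n : ℤ) : V →ₗ[ℂ] Module.End ℂ W :=
  DirectSum.toModule ℂ ℤ (Module.End ℂ W) (fun k => ∑ᶠ j : ℕ, oppTerm φ n k j) ∘ₗ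
    (gradeEquiv (V := V)).symm.toLinearMap

theorem oppTerm_finite (φ : ℤ → V →ₗ[ℂ] Module.End ℂ W) (n k : ℤ) :
    Function.HasFiniteSupport (oppTerm φ n k) := by
  obtain ⟨N, hN⟩ := vL_one_pow_eventually_zero (V := V) k
  refine finite_of_bound _ N fun j hj => ?_
  ext a : 1
  simp [oppTerm, hN j hj a a.2]

theorem oppMode_apply (φ : ℤ → V →ₗ[ℂ] Module.End ℂ W) (n k : ℤ) (a : V) (ha : a ∈ grade k) (u : W) :
    oppMode φ n a u = ∑ᶠ j : ℕ, ((-1 : ℂ) ^ k * (j.factorial : ℂ)⁻¹) •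
      φ (2 * k - n - j - 2) (((vL V 1) ^ j) a) u := by
  rw [oppMode, LinearMap.comp_apply, LinearEquiv.coe_coe, gradeEquiv_symm_apply k a ha,
    DirectSum.toModule_lof]
  have h2 := map_finsum ((LinearMap.applyₗ u) ∘ₗ LinearMap.applyₗ (R := ℂ) (⟨a, ha⟩ : grade (V := V) k))
    (oppTerm_finite φ n k)
  exact h2

theorem oppMode_finite (φ : ℤ → V →ₗ[ℂ] Module.End ℂ W) (n k : ℤ) (a : V) (ha : a ∈ grade k)
    (u : W) : Function.HasFiniteSupport fun j : ℕ => ((-1 : ℂ) ^ k * (j.factorial : ℂ)⁻¹) •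
      φ (2 * k - n - j - 2) (((vL V 1) ^ j) a) u := by
  obtain ⟨N, hN⟩ := vL_one_pow_eventually_zero (V := V) k
  refine finite_of_bound _ N fun j hj => ?_
  simp [hN j hj a ha]

end Opp

variable (V) (M : Type*) [AddCommGroup M] [Module ℂ M] [AdmissibleModule V M]

/-- The graded dual `M' = ⨁ M(n)*`: the linear functionals on `M` that vanish on `M(n)` for all
large `n`. -/
def Contra : Submodule ℂ (Module.Dual ℂ M) where
  carrier := {f | ∃ N : ℕ, ∀ n, N ≤ n → ∀ u ∈ AdmissibleModule.grade V (M := M) n, f u = 0}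
  zero_mem' := ⟨0, fun _ _ _ _ => rfl⟩
  add_mem' := by
    rintro f g ⟨N, hf⟩ ⟨N', hg⟩
    refine ⟨max N N', fun n hn u hu => ?_⟩
    rw [LinearMap.add_apply, hf n (le_of_max_le_left hn) u hu, hg n (le_of_max_le_right hn) u hu,
      add_zero]
  smul_mem' := by
    rintro c f ⟨N, hf⟩
    exact ⟨N, fun n hn u hu => by rw [LinearMap.smul_apply, hf n hn u hu, smul_zero]⟩

theorem oppMode_mem (k n : ℤ) (a : V) (ha : a ∈ grade k) (m : ℕ) (u : M)
    (hu : u ∈ AdmissibleModule.grade V m) :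
    oppMode (mmode V M) n a u ∈ extendGrade (AdmissibleModule.grade V (M := M)) (m + n + 1 - k) := by
  rw [oppMode_apply _ n k a ha]
  refine finsum_induction (p := fun x => x ∈ extendGrade (AdmissibleModule.grade V (M := M)) _)
    (zero_mem _) (fun x y => add_mem) fun j => Submodule.smul_mem _ _ ?_
  have := AdmissibleModule.mode_mem (k - j) _ (vL_one_pow_mem k a ha j) (2 * k - n - j - 2) m u hu
  have e : (m : ℤ) + (k - j) - (2 * k - n - j - 2) - 1 = m + n + 1 - k := by ring
  rwa [e] at this

theorem extendGrade_apply_eq_zero (f : Module.Dual ℂ M) (N : ℤ)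
    (hf : ∀ n : ℕ, N ≤ n → ∀ u ∈ AdmissibleModule.grade V (M := M) n, f u = 0) (d : ℤ) (hd : N ≤ d)
    (u : M) (hu : u ∈ extendGrade (AdmissibleModule.grade V (M := M)) d) : f u = 0 := by
  rw [extendGrade] at hu
  split_ifs at hu with h
  · exact hf d.toNat (by lia) u hu
  · rw [(Submodule.mem_bot ℂ).1 hu, map_zero]

theorem contra_transpose (n : ℤ) (a : V) (f : Module.Dual ℂ M) (hf : f ∈ Contra V M) :
    f ∘ₗ oppMode (mmode V M) n a ∈ Contra V M := by
  induction a using homogeneous_induction with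
  | h k a ha =>
    obtain ⟨N, hN⟩ := hf
    refine ⟨(N - n - 1 + k).toNat, fun m hm u hu => ?_⟩
    exact extendGrade_apply_eq_zero V M f N (fun n hn => hN n (by lia)) _ (by lia) _
      (oppMode_mem V M k n a ha m u hu)
  | hadd a b ha hb =>
    rw [map_add, LinearMap.comp_add]
    exact add_mem ha hb

/-- The operation of the contragredient module `M'`: `a(n)` acts on `M'` as the transpose of
`a'(n)` acting on `M`. -/
def contraMode (n : ℤ) : V →ₗ[ℂ] Module.End ℂ (Contra V M) where
  toFun a :=
    { toFun := fun f => ⟨f.1 ∘ₗ oppMode (mmode V M) n a, contra_transpose V M n a f.1 f.2⟩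
      map_add' := fun f g => rfl
      map_smul' := fun c f => rfl }
  map_add' a b := by
    ext f u
    change f.1 (oppMode (mmode V M) n (a + b) u) = f.1 _ + f.1 _
    rw [map_add, LinearMap.add_apply, map_add]
  map_smul' c a := by
    ext f u
    change f.1 (oppMode (mmode V M) n (c • a) u) = c • f.1 _
    rw [map_smul, LinearMap.smul_apply, map_smul]

theorem contraMode_apply (n : ℤ) (a : V) (f : Contra V M) (u : M) :
    (contraMode V M n a f).1 u = f.1 (oppMode (mmode V M) n a u) := rfl

theorem sum_alternating (N : ℕ) : ∑ ij ∈ Finset.HasAntidiagonal.antidiagonal N,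
    (-1 : ℂ) ^ ij.1 * ((ij.1.factorial : ℂ)⁻¹ * (ij.2.factorial : ℂ)⁻¹) = if N = 0 then 1 else 0 := by
  have h := Finset.sum_congr rfl (fun ij hij => show
    (N.factorial : ℂ) * ((-1 : ℂ) ^ ij.1 * ((ij.1.factorial : ℂ)⁻¹ * (ij.2.factorial : ℂ)⁻¹)) =
      (-1 : ℂ) ^ ij.1 * (N.choose ij.1 : ℂ) by
    rw [← Finset.HasAntidiagonal.mem_antidiagonal.1 hij, Nat.cast_add_choose]
    field_simp) (s₁ := Finset.HasAntidiagonal.antidiagonal N)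
  rw [← Finset.mul_sum] at h
  have h2 : (∑ k ∈ Finset.range (N + 1), (-1 : ℂ) ^ k * (N.choose k : ℂ)) =
      if N = 0 then 1 else 0 := by
    have := Int.alternating_sum_range_choose (n := N)
    exact_mod_cast congrArg (Int.cast : ℤ → ℂ) this
  have hN : (N.factorial : ℂ) ≠ 0 := by exact_mod_cast N.factorial_ne_zero
  apply mul_left_cancel₀ hN
  rw [h, Finset.Nat.sum_antidiagonal_eq_sum_range_succ_mk, h2]
  split_ifs with h0
  · simp [h0]
  · simp

theorem finsum_alternating (g : ℕ → ℂ) (N : ℕ) (hg : ∀ i, N ≤ i → g i = 0) :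
    ∑ᶠ j : ℕ, ∑ᶠ i : ℕ, (-1 : ℂ) ^ j * ((j.factorial : ℂ)⁻¹ * (i.factorial : ℂ)⁻¹) * g (j + i) =
      g 0 := by
  set X : ℕ × ℕ → ℂ := fun x =>
    (-1 : ℂ) ^ x.1 * ((x.1.factorial : ℂ)⁻¹ * (x.2.factorial : ℂ)⁻¹) * g (x.1 + x.2) with hX
  have hs : Function.support X ⊆ (Finset.range N ×ˢ Finset.range N : Finset (ℕ × ℕ)) := by
    intro x hx
    by_contra hc
    apply hx
    rw [hX]
    simp only
    rw [hg _ (by simp at hc; lia), mul_zero]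
  have h1 := finsum_curry X ((Finset.finite_toSet _).subset hs)
  change ∑ᶠ j : ℕ, ∑ᶠ i : ℕ, X (j, i) = g 0
  rw [← h1, finsum_eq_sum_of_support_subset X hs,
    ← Finset.sum_fiberwise_of_maps_to (t := Finset.range (2 * N)) (g := fun x => x.1 + x.2)]
  · have h2 : ∀ n ∈ Finset.range (2 * N),
        (∑ x ∈ Finset.range N ×ˢ Finset.range N with x.1 + x.2 = n, X x) =
          if n = 0 then g 0 else 0 := by
      intro n _
      by_cases hn : n < N
      · have e : (Finset.range N ×ˢ Finset.range N).filter (fun x => x.1 + x.2 = n) =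
            Finset.HasAntidiagonal.antidiagonal n := by
          ext x
          simp
          lia
        rw [e, Finset.sum_congr rfl (g := fun x => (-1 : ℂ) ^ x.1 * ((x.1.factorial : ℂ)⁻¹ *
          (x.2.factorial : ℂ)⁻¹) * g n) (fun x hx => by
            rw [hX, ← Finset.HasAntidiagonal.mem_antidiagonal.1 hx]), ← Finset.sum_mul,
          sum_alternating]
        split_ifs with h0
        · rw [h0, one_mul]
        · rw [zero_mul]
      · rw [Finset.sum_eq_zero]
        · split_ifs with h0
          · rw [hg 0 (by lia)]
          · rfl
        · intro x hx
          rw [hX]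
          simp only
          rw [(Finset.mem_filter.1 hx).2, hg n (by lia), mul_zero]
    rw [Finset.sum_congr rfl h2, Finset.sum_ite_eq']
    split_ifs with h0
    · rfl
    · rw [hg 0 (by simp at h0; lia)]
  · intro x hx
    simp at hx ⊢
    lia

/-- The relation `Y'' = Y`. -/
theorem oppMode_contraMode (n : ℤ) (a : V) (f : Contra V M) (u : M) :
    (oppMode (contraMode V M) n a f).1 u = f.1 (mmode V M n a u) := by
  induction a using homogeneous_induction with
  | hadd a b ha hb =>
    rw [map_add, map_add, LinearMap.add_apply, LinearMap.add_apply, map_add, ← ha, ← hb]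
    rfl
  | h k a ha =>
    rw [oppMode_apply _ n k a ha]
    let ev : Contra V M →ₗ[ℂ] ℂ := LinearMap.applyₗ u ∘ₗ (Contra V M).subtype
    change ev _ = _
    rw [map_finsum ev (oppMode_finite _ n k a ha f)]
    obtain ⟨N, hN⟩ := vL_one_pow_eventually_zero (V := V) k
    have hg := finsum_alternating (fun i => f.1 (mmode V M (n - i) (((vL V 1) ^ i) a) u)) N
      (fun i hi => by simp [hN i hi a ha])
    simp only [pow_zero, Module.End.one_apply, Nat.cast_zero, sub_zero] at hg
    rw [← hg]
    refine finsum_congr fun j => ?_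
    rw [map_smul]
    change _ • f.1 (oppMode (mmode V M) _ _ u) = _
    have hj := vL_one_pow_mem k a ha j
    rw [oppMode_apply _ _ _ _ hj, map_finsum f.1 (oppMode_finite _ _ _ _ hj u), smul_finsum]
    refine finsum_congr fun i => ?_
    have e1 : 2 * (k - j) - (2 * k - n - j - 2) - i - 2 = n - ((j + i : ℕ) : ℤ) := by
      push_cast
      ring
    have e2 : ((vL V 1) ^ i) (((vL V 1) ^ j) a) = ((vL V 1) ^ (j + i)) a := by
      rw [add_comm, pow_add, Module.End.mul_apply]
    have e3 : (-1 : ℂ) ^ k * (-1 : ℂ) ^ (k - (j : ℤ)) = (-1 : ℂ) ^ j := by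
      rw [← zpow_add₀ (by norm_num), ← zpow_natCast]
      have : k + (k - j) = 2 * (k - j) + j := by ring
      rw [this, zpow_add₀ (by norm_num), zpow_mul]
      simp
    rw [map_smul, e1, e2, smul_smul, smul_eq_mul, ← e3]
    ring

/-- The coefficients of the operation attached to the point `∞`, in the coordinate `1 / z`. -/
def inftyMode (p : ℤ) : V →ₗ[ℂ] Module.End ℂ (Contra V M) :=
  (-1 : ℂ) • oppMode (contraMode V M) (-p)

theorem inftyMode_apply (p : ℤ) (a : V) (f : Contra V M) (u : M) :
    (inftyMode V M p a f).1 u = -f.1 (mmode V M (-p) a u) := by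
  rw [← oppMode_contraMode, ← neg_one_mul]
  rfl

theorem inftyMode_eq_zero (f : Contra V M) (N : ℤ)
    (hf : ∀ n : ℕ, N ≤ n → ∀ u ∈ AdmissibleModule.grade V (M := M) n, f.1 u = 0) (k : ℤ) (a : V)
    (ha : a ∈ grade k) (p : ℤ) (m : ℕ) (u : M) (hu : u ∈ AdmissibleModule.grade V m)
    (hp : N ≤ m + k + p - 1) : (inftyMode V M p a f).1 u = 0 := by
  rw [inftyMode_apply, mmode_apply, extendGrade_apply_eq_zero V M f.1 N hf _ _ _
    (AdmissibleModule.mode_mem k a ha (-p) m u hu), neg_zero]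
  lia

theorem inftyMode_truncated : Truncated (inftyMode V M) := by
  intro a f
  obtain ⟨N, hN⟩ := f.2
  induction a using homogeneous_induction with
  | hadd a b ha hb =>
    obtain ⟨A, hA⟩ := ha
    obtain ⟨B, hB⟩ := hb
    refine ⟨max A B, fun n hn => ?_⟩
    rw [map_add, LinearMap.add_apply, hA n (le_of_max_le_left hn), hB n (le_of_max_le_right hn),
      add_zero]
  | h k a ha =>
    refine ⟨N - k + 1, fun n hn => ?_⟩
    apply Subtype.ext
    ext u
    induction u using module_homogeneous_induction (V := V) with
    | hadd u w hu hw => rw [map_add, hu, hw, map_add]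
    | h m u hu =>
      exact inftyMode_eq_zero V M f N (fun n hn => hN n (by lia)) k a ha n m u hu (by lia)

theorem inftyMode_translation (a : V) (n : ℤ) :
    inftyMode V M n (vL V (-1) a) = (n : ℂ) • inftyMode V M (n + 1) a := by
  ext f u
  rw [LinearMap.smul_apply]
  change _ = (n : ℂ) • (inftyMode V M (n + 1) a f).1 u
  rw [inftyMode_apply, inftyMode_apply, mmode_translation, LinearMap.smul_apply, map_smul]
  have e : -n - 1 = -(n + 1) := by ring
  rw [e]
  push_cast
  simp

/-- The action of the chiral Lie algebra on `M'` attached to the point `∞`. -/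
def rhoInfty : ChiralLie V →ₗ[ℂ] Module.End ℂ (Contra V M) :=
  CurrentLie.lift V _ (residueMap (inftyMode V M) (inftyMode_truncated V M) expandInfty) (by
    intro x
    induction x using TensorProduct.induction_on with
    | zero => simp
    | add x y hx hy => rw [map_add, map_add, hx, hy, add_zero]
    | tmul a f =>
      ext1 w
      simp only [nabla, LinearMap.add_apply, TensorProduct.map_tmul, LinearMap.id_apply, map_add,
        residueMap_tmul, residue_apply, LinearMap.zero_apply, Derivation.coeFn_coe]
      rw [← finsum_comp_equiv (Equiv.addRight (1 : ℤ))
          (f := fun n => (expandInfty (ddz _ f)).coeff n • inftyMode V M n a w),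
        ← finsum_add_distrib]
      · rw [← finsum_zero (α := ℤ)]
        refine finsum_congr fun n => ?_
        simp only [Equiv.coe_addRight, inftyMode_translation, expandInfty_ddz, add_sub_cancel_right,
          LinearMap.smul_apply, smul_smul, ← add_smul]
        push_cast
        ring_nf
        simp
      · exact residue_finite (inftyMode_truncated V M) _ _ w
      · exact Function.HasFiniteSupport.comp_of_injective (Equiv.injective _)
          (residue_finite (inftyMode_truncated V M) _ _ w))

theorem rhoInfty_mk (a : V) (f : ChiralRing) (v : Contra V M) :
    rhoInfty V M (CurrentLie.mk V _ (a ⊗ₜ f)) v =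
      ∑ᶠ n : ℤ, (expandInfty f).coeff n • inftyMode V M n a v := rfl

/-- The bottom level of the contragredient module as a subspace, i.e. the linear functionals on `M` that
vanish on `M(n)` for all `n > 0`. -/
def bottomDualSubmodule : Submodule ℂ (Contra V M) where
  carrier := {f | ∀ n, 0 < n → ∀ u ∈ AdmissibleModule.grade V (M := M) n, f.1 u = 0}
  zero_mem' := fun _ _ _ _ => rfl
  add_mem' := fun {f g} hf hg n hn u hu => by
    change f.1 u + g.1 u = 0
    rw [hf n hn u hu, hg n hn u hu, add_zero]
  smul_mem' := fun c f hf n hn u hu => by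
    change c • f.1 u = 0
    rw [hf n hn u hu, smul_zero]

theorem rhoInfty_mem_bottomDual (x : chiralLE V) (f : Contra V M) (hf : f ∈ bottomDualSubmodule V M) :
    rhoInfty V M x f ∈ bottomDualSubmodule V M := by
  have hx := x.2
  rw [mem_chiralLE, chiralFil] at hx
  generalize (x : ChiralLie V) = y at hx
  induction hx using Submodule.span_induction with
  | zero => simp
  | add x y _ _ hx hy => rw [map_add]; exact add_mem hx hy
  | smul c x _ hx => rw [map_smul]; exact Submodule.smul_mem _ _ hx
  | mem x hx =>
    obtain ⟨k, a, ha, n, m, hnm, rfl⟩ := hx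
    rw [chiralElt, rhoInfty_mk]
    refine finsum_induction (p := fun x => x ∈ bottomDualSubmodule V M) (zero_mem _)
      (fun x y => add_mem) fun p => ?_
    by_cases hp : p < m - n
    · rw [expandInfty_chiralFn n m p hp, zero_smul]
      exact zero_mem _
    · refine Submodule.smul_mem _ _ fun d hd u hu => ?_
      exact inftyMode_eq_zero V M f 1 (fun n hn => hf n (by lia)) k a ha p d u hu (by lia)

/-- The bottom level `M'(0) = M(0)*` of the contragredient module. -/
def BottomDual : Type _ := bottomDualSubmodule V M

instance : AddCommGroup (BottomDual V M) := inferInstanceAs (AddCommGroup (bottomDualSubmodule V M))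

instance : Module ℂ (BottomDual V M) := inferInstanceAs (Module ℂ (bottomDualSubmodule V M))

/-- The pairing of `M(0)*` and `M(0)`. -/
def bottomPairing : BottomDual V M →ₗ[ℂ] Bottom V M →ₗ[ℂ] ℂ :=
  (bottomIncl V M).dualMap ∘ₗ (Contra V M).subtype ∘ₗ (bottomDualSubmodule V M).subtype

/-- The action of the `∞`-restricted chiral Lie algebra on `M(0)*`. -/
def rhoBottomDual (x : chiralLE V) : Module.End ℂ (BottomDual V M) :=
  LinearMap.restrict (rhoInfty V M x) (fun f hf => rhoInfty_mem_bottomDual V M x f hf)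

end Contragredient

/-! ### Restricted conformal blocks -/

section Blocks

attribute [local instance] LieRing.ofAssociativeRing

variable (V : Type*) [AddCommGroup V] [Module ℂ V] [VertexOperatorAlgebra V]
variable (M₃ M₁ M₂ : Type*) [AddCommGroup M₃] [Module ℂ M₃] [AdmissibleModule V M₃]
  [AddCommGroup M₁] [Module ℂ M₁] [AdmissibleModule V M₁]
  [AddCommGroup M₂] [Module ℂ M₂] [AdmissibleModule V M₂]

/-- The action of the `∞`-restricted chiral Lie algebra on `M₃(0)* ⊗ M₁ ⊗ M₂`. -/
def restrictedAction (x : chiralLE V) : Module.End ℂ (BottomDual V M₃ ⊗[ℂ] (M₁ ⊗[ℂ] M₂)) :=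
  TensorProduct.map (rhoBottomDual V M₃ x) LinearMap.id +
    TensorProduct.map LinearMap.id (rhoOneZero V M₁ M₂ x)

/-- The image of the action of the `∞`-restricted chiral Lie algebra on `M₃(0)* ⊗ M₁ ⊗ M₂`. -/
def restrictedImage : Submodule ℂ (BottomDual V M₃ ⊗[ℂ] (M₁ ⊗[ℂ] M₂)) :=
  Submodule.span ℂ {t | ∃ x s, t = restrictedAction V M₃ M₁ M₂ x s}

/-- The space of `∞`-restricted conformal blocks for `(M₃(0)*, M₁, M₂)`, the dual space of the
coinvariants. -/
abbrev RestrictedBlocks : Type _ :=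
  Module.Dual ℂ ((BottomDual V M₃ ⊗[ℂ] (M₁ ⊗[ℂ] M₂)) ⧸ restrictedImage V M₃ M₁ M₂)

end Blocks

end ConformalBlocks

end

open ConformalBlocks

/-!
The elements `a ⊗ zⁿ/(z-1)ᵐ` are filtered by their pole order `n - m` at `z = ∞`, compared with
`wt a - 1`, and both parts of the theorem come from looking at the leading term there.

For the first part, `zⁿ/(z-1)ᵐ - zⁿ⁻¹/(z-1)ᵐ⁻¹ = zⁿ⁻¹/(z-1)ᵐ` has smaller degree, so that modulo the
augmented ideal `a ⊗ zⁿ/(z-1)ᵐ` is `a ⊗ zⁿ⁻ᵐ`: the map from `L(V)_0` is surjective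
(`exists_borcherdsZero_sub_mem`). For injectivity, expansion at `z = ∞` followed by the projection
to degree zero, `a ⊗ f ↦ f_(wt a - 1) a_[wt a - 1]`, respects the relations `L(-1)a ⊗ f + a ⊗ f'`.
It therefore defines a linear map `degreeZeroPart` from the whole chiral Lie algebra to `L(V)`, which
kills the augmented ideal and is a left inverse of the inclusion of `L(V)_0`.

For the second part, `M₃(0)` is finite-dimensional, so that functionals `ψ` on `M₃(0)* ⊗ T` are the
same as linear maps `F : T → M₃(0)` (`dualTensorEquivHom`); here `T = M₁ ⊗ M₂`. By the first part the
`∞`-restricted chiral Lie algebra is the sum of the augmented ideal and the image of `L(V)_0`. The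
augmented ideal acts by zero on `M₃(0)*` (`rhoBottomDual_eq_zero`), so that invariance of `ψ` under
it means that `F` factors through `M₁ ⊙ M₂`. On `M₃(0)*` the Lie algebra `L(V)_0` acts by minus the
transpose of its action on `M₃(0)` (`bottomPairing_rhoBottomDual`), so that invariance of `ψ` under
it means that `F` is equivariant. This is `restrictedImage_le_ker_iff`.
-/

namespace ConformalBlocks

open VertexOperatorAlgebra

/-! ### The degree zero part of the chiral Lie algebra -/

section DegreeZero

variable (V : Type*) [AddCommGroup V] [Module ℂ V] [VertexOperatorAlgebra V]

variable {V} in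
/-- Modulo lower degree, `a ⊗ zⁿ / (z - 1)ᵐ` depends on `n - m` only, because `z / (z - 1)` is `1`
at `z = ∞`. -/
theorem chiralElt_sub_mem_chiralFil (d k : ℤ) (a : V) (ha : a ∈ grade k) (n m : ℤ)
    (h : n - m ≤ k - 1 - d) :
    chiralElt a n m - chiralElt a (n - m) 0 ∈ chiralFil V (d + 1) := by
  -- `zⁿ/(z-1)ᵐ - zⁿ⁻¹/(z-1)ᵐ⁻¹ = zⁿ⁻¹/(z-1)ᵐ` has smaller degree
  have step (n m : ℤ) : chiralElt a n m - chiralElt a (n - 1) (m - 1) = chiralElt a (n - 1) m := by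
    have hz : chiralFn 1 0 - chiralFn 0 (-1) = 1 := by
      simp [chiralFn, chiralZ, chiralZ1]
    have hf : chiralFn n m - chiralFn (n - 1) (m - 1) = chiralFn (n - 1) m := by
      have h1 : chiralFn n m = chiralFn 1 0 * chiralFn (n - 1) m := by
        rw [chiralFn_mul]; congr 1 <;> ring
      have h2 : chiralFn (n - 1) (m - 1) = chiralFn 0 (-1) * chiralFn (n - 1) m := by
        rw [chiralFn_mul]; congr 1 <;> ring
      rw [h1, h2, ← sub_mul, hz, one_mul]
    rw [chiralElt, chiralElt, chiralElt, ← map_sub, ← TensorProduct.tmul_sub, hf]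
  have hmem (n' m' : ℤ) (h' : n' - m' = n - m) : chiralElt a (n' - 1) m' ∈ chiralFil V (d + 1) :=
    Submodule.subset_span ⟨k, a, ha, n' - 1, m', by lia, rfl⟩
  have key (c m : ℤ) (hc : ∀ m', chiralElt a (c + m' - 1) m' ∈ chiralFil V (d + 1)) :
      chiralElt a (c + m) m - chiralElt a c 0 ∈ chiralFil V (d + 1) := by
    induction m using Int.induction_on with
    | zero => simp
    | succ i ih =>
      have h1 := add_mem (hc (i + 1)) ih
      rw [← step] at h1
      convert h1 using 1
      have e1 : c + (i + 1 : ℤ) - 1 = c + i := by ring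
      have e2 : (i + 1 : ℤ) - 1 = i := by ring
      rw [e1, e2]
      abel
    | pred i ih =>
      have h1 := sub_mem ih (hc (-i))
      rw [← step] at h1
      convert h1 using 1
      have e1 : c + (-(i : ℤ) - 1) = c + -i - 1 := by ring
      rw [e1]
      abel
  have := key (n - m) m (fun m' => hmem (n - m + m') m' (by ring))
  rwa [sub_add_cancel] at this

/-- The `∞`-restricted chiral Lie algebra is the sum of the image of `L(V)_0` and the augmented
ideal. -/
theorem exists_borcherdsZero_sub_mem (x : chiralLE V) :
    ∃ y : borcherdsZero V, x - borcherdsZeroToChiral V y ∈ chiralLT V := by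
  obtain ⟨x, hx⟩ := x
  change x ∈ chiralFil V 0 at hx
  suffices h : ∃ y : borcherdsZero V, x - borcherdsToChiral V y ∈ chiralFil V 1 from h
  induction hx using Submodule.span_induction with
  | zero => exact ⟨0, by simp⟩
  | add x x' _ _ hx hx' =>
    obtain ⟨y, hy⟩ := hx
    obtain ⟨y', hy'⟩ := hx'
    refine ⟨y + y', ?_⟩
    have := add_mem hy hy'
    simpa [add_sub_add_comm] using this
  | smul c x _ hx =>
    obtain ⟨y, hy⟩ := hx
    refine ⟨c • y, ?_⟩
    have := Submodule.smul_mem _ c hy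
    simpa [smul_sub] using this
  | mem x hx =>
    obtain ⟨k, a, ha, n, m, hnm, rfl⟩ := hx
    by_cases hd : n - m = k - 1
    · refine ⟨⟨borcherdsElt a (k - 1), Submodule.subset_span ⟨k, a, ha, rfl⟩⟩, ?_⟩
      rw [borcherdsToChiral_elt, ← hd]
      simpa using chiralElt_sub_mem_chiralFil 0 k a ha n m hnm
    · refine ⟨0, ?_⟩
      have h : chiralElt a n m ∈ chiralFil V 1 :=
        Submodule.subset_span ⟨k, a, ha, n, m, by lia, rfl⟩
      simpa using h

theorem expandInfty_chiralFn_zero (n : ℤ) :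
    expandInfty (chiralFn n 0) = HahnSeries.single (-n) 1 := by
  have h0 : expandInfty (chiralZ : ChiralRing) = HahnSeries.single (-1) 1 := evalAt_coord _ _ _
  have h1 : Units.map (expandInfty : ChiralRing →* LaurentSeries ℂ) chiralZ =
      Units.mk0 (HahnSeries.single (-1) 1) (by simp) := by
    ext1
    exact h0
  have h2 : expandInfty (chiralFn n 0) =
      ((Units.map (expandInfty : ChiralRing →* LaurentSeries ℂ) (chiralZ ^ n) :
        (LaurentSeries ℂ)ˣ) : LaurentSeries ℂ) := by
    rw [chiralFn, neg_zero, zpow_zero, mul_one]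
    rfl
  rw [h2, map_zpow, h1, Units.val_zpow_eq_zpow_val, Units.val_mk0, RatFunc.single_zpow (-1),
    ← zpow_mul, neg_one_mul, ← RatFunc.single_zpow]

/-- The coefficient of `zⁿ` in the expansion at `z = ∞`. -/
noncomputable def inftyCoeff (n : ℤ) : ChiralRing →ₗ[ℂ] ℂ where
  toFun f := (expandInfty f).coeff (-n)
  map_add' f g := by simp
  map_smul' c f := by simp [laurent_map_smul]

theorem inftyCoeff_ddz (n : ℤ) (f : ChiralRing) :
    inftyCoeff n (ddz _ f) = (n + 1) * inftyCoeff (n + 1) f := by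
  change (expandInfty _).coeff _ = _ * (expandInfty f).coeff _
  rw [expandInfty_ddz]
  have e : -n - 1 = -(n + 1) := by ring
  rw [e]
  push_cast
  ring

/-- The map `a ⊗ f ↦ f_(wt a - 1) a_[wt a - 1]` for homogeneous `a`, where `f = ∑ f_s zˢ` is the
expansion at `z = ∞`. -/
noncomputable def preDegreeZeroPart : V ⊗[ℂ] ChiralRing →ₗ[ℂ] BorcherdsLie V :=
  TensorProduct.lift (DirectSum.toModule ℂ ℤ (ChiralRing →ₗ[ℂ] BorcherdsLie V)
    (fun k => LinearMap.smulRightₗ (inftyCoeff (k - 1)) ∘ₗ CurrentLie.mk V _ ∘ₗ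
      (TensorProduct.mk ℂ V LaurentRing).flip (laurentFn (k - 1)) ∘ₗ (grade (V := V) k).subtype) ∘ₗ
    (gradeEquiv (V := V)).symm.toLinearMap)

theorem preDegreeZeroPart_tmul (k : ℤ) (a : V) (ha : a ∈ grade k) (f : ChiralRing) :
    preDegreeZeroPart V (a ⊗ₜ f) = inftyCoeff (k - 1) f • borcherdsElt a (k - 1) := by
  rw [preDegreeZeroPart, TensorProduct.lift.tmul, LinearMap.comp_apply, LinearEquiv.coe_coe,
    gradeEquiv_symm_apply k a ha, DirectSum.toModule_lof]
  rfl

variable {V} in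
theorem borcherdsElt_translation (a : V) (n : ℤ) :
    borcherdsElt (vL V (-1) a) n = -(n : ℂ) • borcherdsElt a (n - 1) := by
  rw [neg_smul, eq_neg_iff_add_eq_zero, borcherdsElt, borcherdsElt, ← map_smul,
    ← TensorProduct.tmul_smul, ← ddz_laurentFn, ← map_add, CurrentLie.mk_eq_zero]
  exact ⟨a ⊗ₜ laurentFn n, rfl⟩

/-- The projection of the chiral Lie algebra to the degree zero part of the Borcherds Lie algebra:
expansion at `z = ∞` followed by the projection to the component of degree zero. It is linear,
but in general not a Lie homomorphism on the whole chiral Lie algebra. -/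
noncomputable def degreeZeroPart : ChiralLie V →ₗ[ℂ] BorcherdsLie V :=
  CurrentLie.lift V _ (preDegreeZeroPart V) (fun x => by
    induction x using TensorProduct.induction_on with
    | zero => simp
    | add x y hx hy => rw [map_add, map_add, hx, hy, add_zero]
    | tmul a f =>
      -- for `a` of weight `k`, the relation is `(L(-1)a)_[k] = -k a_[k - 1]`
      induction a using homogeneous_induction with
      | hadd a b ha hb => rw [TensorProduct.add_tmul, map_add, map_add, ha, hb, add_zero]
      | h k a ha =>
        have hL : vL V (-1) a ∈ grade (k + 1) := by
          have := vmode_mem 2 k 0 omega a omega_mem ha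
          have e : 2 + k - 0 - 1 = k + 1 := by ring
          rwa [e] at this
        rw [nabla_tmul, map_add, preDegreeZeroPart_tmul V k a ha,
          preDegreeZeroPart_tmul V (k + 1) _ hL, borcherdsElt_translation, inftyCoeff_ddz,
          smul_smul, add_sub_cancel_right, sub_add_cancel, ← add_smul]
        push_cast
        ring_nf
        simp)

theorem degreeZeroPart_elt (k : ℤ) (a : V) (ha : a ∈ grade k) (n m : ℤ) :
    degreeZeroPart V (chiralElt a n m) =
      inftyCoeff (k - 1) (chiralFn n m) • borcherdsElt a (k - 1) :=
  preDegreeZeroPart_tmul V k a ha _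

/-- The map `degreeZeroPart` is a left inverse of the map from `L(V)_0` to the chiral Lie algebra.
Since it also kills the augmented ideal, the map to the quotient is injective. -/
theorem degreeZeroPart_borcherdsToChiral (y : borcherdsZero V) :
    degreeZeroPart V (borcherdsToChiral V y) = y := by
  have hy := y.2
  rw [mem_borcherdsZero] at hy
  generalize (y : BorcherdsLie V) = z at hy ⊢
  induction hy using Submodule.span_induction with
  | zero => simp
  | add x y _ _ hx hy => rw [map_add, map_add, hx, hy]
  | smul c x _ hx => rw [map_smul, map_smul, hx]
  | mem x hx =>
    obtain ⟨k, a, ha, rfl⟩ := hx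
    rw [borcherdsToChiral_elt, degreeZeroPart_elt V k a ha]
    change (expandInfty _).coeff _ • _ = _
    rw [expandInfty_chiralFn_zero, HahnSeries.coeff_single_same, one_smul]

theorem degreeZeroPart_eq_zero (x : ChiralLie V) (hx : x ∈ chiralFil V 1) :
    degreeZeroPart V x = 0 := by
  induction hx using Submodule.span_induction with
  | zero => simp
  | add x y _ _ hx hy => rw [map_add, hx, hy, add_zero]
  | smul c x _ hx => rw [map_smul, hx, smul_zero]
  | mem x hx =>
    obtain ⟨k, a, ha, n, m, hnm, rfl⟩ := hx
    rw [degreeZeroPart_elt V k a ha]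
    change (expandInfty _).coeff _ • _ = _
    rw [expandInfty_chiralFn n m _ (by lia), zero_smul]

theorem borcherdsZeroToQuotient_bijective : Function.Bijective (borcherdsZeroToQuotient V) := by
  constructor
  · rw [injective_iff_map_eq_zero]
    intro y hy
    have h : borcherdsZeroToChiral V y ∈ chiralLT V :=
      (LieSubmodule.Quotient.mk_eq_zero (N := chiralLT V)).1 hy
    have h1 := degreeZeroPart_eq_zero V _ ((mem_chiralLT V _).1 h)
    ext
    exact (degreeZeroPart_borcherdsToChiral V y).symm.trans h1
  · intro x
    obtain ⟨x, rfl⟩ := LieSubmodule.Quotient.surjective_mk' (chiralLT V) x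
    obtain ⟨y, hy⟩ := exists_borcherdsZero_sub_mem V x
    refine ⟨y, ?_⟩
    have := (LieSubmodule.Quotient.mk_eq_zero (N := chiralLT V)).2 hy
    exact (sub_eq_zero.1 this).symm

end DegreeZero

/-! ### The bottom level of the contragredient module -/

section BottomDual

attribute [local instance] LieRing.ofAssociativeRing

variable (V : Type*) [AddCommGroup V] [Module ℂ V] [VertexOperatorAlgebra V]
variable (M : Type*) [AddCommGroup M] [Module ℂ M] [AdmissibleModule V M]

/-- An element of the augmented ideal acts on `M(0)*` by composing a functional that is supported on
`M(0)` with operators that strictly raise the degree in `M`. -/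
theorem rhoBottomDual_eq_zero (x : chiralLE V) (hx : x ∈ chiralLT V) :
    rhoBottomDual V M x = 0 := by
  suffices h : ∀ y ∈ chiralFil V 1, ∀ f ∈ bottomDualSubmodule V M, rhoInfty V M y f = 0 by
    ext f : 1
    exact Subtype.ext (h x hx f.1 f.2)
  intro y hy f hf
  induction hy using Submodule.span_induction with
  | zero => simp
  | add x y _ _ hx hy => rw [map_add, LinearMap.add_apply, hx, hy, add_zero]
  | smul c x _ hx => rw [map_smul, LinearMap.smul_apply, hx, smul_zero]
  | mem y hy =>
    obtain ⟨k, a, ha, n, m, hnm, rfl⟩ := hy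
    rw [chiralElt, rhoInfty_mk]
    refine finsum_eq_zero_of_forall_eq_zero fun p => ?_
    by_cases hp : p < m - n
    · rw [expandInfty_chiralFn n m p hp, zero_smul]
    · suffices h : inftyMode V M p a f = 0 by rw [h, smul_zero]
      ext u
      induction u using module_homogeneous_induction (V := V) with
      | hadd u w hu hw => rw [map_add, hu, hw, map_add]
      | h d u hu =>
        exact inftyMode_eq_zero V M f 1 (fun n hn => hf n (by lia)) k a ha p d u hu (by lia)

/-- The action on `M(0)*` is contragredient to that of `L(V)_0` on `M(0)`. -/
theorem bottomPairing_rhoBottomDual (y : borcherdsZero V) (v : BottomDual V M) (u : Bottom V M) :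
    bottomPairing V M (rhoBottomDual V M (borcherdsZeroToChiral V y) v) u =
      -bottomPairing V M v ⁅y, u⁆ := by
  change (rhoInfty V M (borcherdsToChiral V y) v.1).1 (bottomIncl V M u) =
    -v.1.1 (rhoBorcherds V M y (bottomIncl V M u))
  have hy := y.2
  rw [mem_borcherdsZero] at hy
  generalize (y : BorcherdsLie V) = z at hy ⊢
  generalize bottomIncl V M u = w
  induction hy using Submodule.span_induction with
  | zero => simp
  | add x y _ _ hx hy =>
    simp only [map_add, LinearMap.add_apply, neg_add, ← hx, ← hy]
    rfl
  | smul c x _ hx =>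
    simp only [map_smul, LinearMap.smul_apply, ← smul_neg, ← hx]
    rfl
  | mem x hx =>
    obtain ⟨k, a, ha, rfl⟩ := hx
    rw [borcherdsToChiral_elt, rhoBorcherds_elt, chiralElt, rhoInfty_mk, expandInfty_chiralFn_zero,
      finsum_eq_single _ (-(k - 1))]
    · rw [HahnSeries.coeff_single_same, one_smul, inftyMode_apply, neg_neg]
    · intro n hn
      rw [HahnSeries.coeff_single_of_ne hn, zero_smul]

/-- The projection of a module to its bottom level. -/
noncomputable def bottomProj : M →ₗ[ℂ] AdmissibleModule.grade V (M := M) 0 :=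
  DirectSum.component ℂ ℕ (fun n => AdmissibleModule.grade V (M := M) n) 0 ∘ₗ
    (LinearEquiv.ofBijective (DirectSum.coeLinearMap (AdmissibleModule.grade V (M := M)))
      (show Function.Bijective _ from AdmissibleModule.isInternal)).symm.toLinearMap

theorem bottomProj_coe (n : ℕ) (u : AdmissibleModule.grade V (M := M) n) :
    bottomProj V M u = DirectSum.component ℂ ℕ (fun n => AdmissibleModule.grade V (M := M) n) 0
      (DirectSum.lof ℂ ℕ (fun n => AdmissibleModule.grade V (M := M) n) n u) := by
  rw [bottomProj, LinearMap.comp_apply]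
  congr 1
  rw [LinearEquiv.coe_coe, LinearEquiv.symm_apply_eq, LinearEquiv.ofBijective_apply,
    DirectSum.coeLinearMap_lof]

theorem bottomProj_coe_zero (u : AdmissibleModule.grade V (M := M) 0) :
    bottomProj V M u = u := by
  rw [bottomProj_coe, DirectSum.component.lof_self]

theorem bottomProj_of_mem (n : ℕ) (hn : 0 < n) (u : M)
    (hu : u ∈ AdmissibleModule.grade V (M := M) n) : bottomProj V M u = 0 := by
  rw [bottomProj_coe V M n ⟨u, hu⟩, DirectSum.component.of]
  exact dif_neg hn.ne'

theorem bottomPairing_injective : Function.Injective (bottomPairing V M) := by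
  rw [injective_iff_map_eq_zero]
  intro f hf
  apply Subtype.ext
  ext u
  induction u using module_homogeneous_induction (V := V) with
  | hadd u w hu hw => rw [map_add, hu, hw, map_add]
  | h n u hu =>
    obtain rfl | hn := n.eq_zero_or_pos
    · exact LinearMap.congr_fun hf ⟨u, hu⟩
    · exact f.2 n hn u hu

theorem bottomPairing_surjective : Function.Surjective (bottomPairing V M) := by
  intro g
  let g' : AdmissibleModule.grade V (M := M) 0 →ₗ[ℂ] ℂ := g
  have h0 : ∀ n, 0 < n → ∀ u ∈ AdmissibleModule.grade V (M := M) n,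
      (g' ∘ₗ bottomProj V M) u = 0 := fun n hn u hu => by
    rw [LinearMap.comp_apply, bottomProj_of_mem V M n hn u hu, map_zero]
  refine ⟨⟨⟨g' ∘ₗ bottomProj V M, 1, fun n hn => h0 n hn⟩, h0⟩, ?_⟩
  ext u
  exact congrArg g' (bottomProj_coe_zero V M u)

/-- For a finite-dimensional bottom level, the pairing of `M(0)*` and `M(0)` identifies `M(0)` with
the dual space of `M(0)*`. -/
noncomputable def bottomEquivDual [FiniteDimensional ℂ (Bottom V M)] :
    Bottom V M ≃ₗ[ℂ] Module.Dual ℂ (BottomDual V M) :=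
  Module.evalEquiv ℂ (Bottom V M) ≪≫ₗ
    (LinearEquiv.ofBijective (bottomPairing V M)
      ⟨bottomPairing_injective V M, bottomPairing_surjective V M⟩).dualMap

theorem bottomEquivDual_apply [FiniteDimensional ℂ (Bottom V M)] (u : Bottom V M)
    (v : BottomDual V M) : bottomEquivDual V M u v = bottomPairing V M v u := rfl

end BottomDual

/-! ### Restricted conformal blocks as homomorphisms -/

section Blocks

attribute [local instance] LieRing.ofAssociativeRing

variable {V : Type*} [AddCommGroup V] [Module ℂ V] [VertexOperatorAlgebra V]
variable {M₁ M₂ M₃ : Type*} [AddCommGroup M₁] [Module ℂ M₁] [AdmissibleModule V M₁]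
  [AddCommGroup M₂] [Module ℂ M₂] [AdmissibleModule V M₂]
  [AddCommGroup M₃] [Module ℂ M₃] [AdmissibleModule V M₃]

/-- A functional `ψ` on `M₃(0)* ⊗ M₁ ⊗ M₂` that corresponds to a map `F : M₁ ⊗ M₂ → M₃(0)` is
invariant under the `∞`-restricted chiral Lie algebra if and only if `F` is `L(V)_0`-equivariant
and kills the image of the augmented ideal: the `∞`-restricted chiral Lie algebra is the sum of
the image of `L(V)_0` and the augmented ideal, which acts by zero on `M₃(0)*`. -/
theorem restrictedImage_le_ker_iff [FiniteDimensional ℂ (Bottom V M₃)]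
    (ψ : BottomDual V M₃ ⊗[ℂ] (M₁ ⊗[ℂ] M₂) →ₗ[ℂ] ℂ) (F : M₁ ⊗[ℂ] M₂ →ₗ[ℂ] Bottom V M₃)
    (h : ∀ v t, ψ (v ⊗ₜ t) = bottomPairing V M₃ v (F t)) :
    restrictedImage V M₃ M₁ M₂ ≤ LinearMap.ker ψ ↔
      odotKernel V M₁ M₂ ≤ LinearMap.ker F ∧ ∀ (y : borcherdsZero V) (t : M₁ ⊗[ℂ] M₂),
        F (rhoOneZero V M₁ M₂ (borcherdsZeroToChiral V y) t) = ⁅y, F t⁆ := by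
  have hsep {u w : Bottom V M₃} (hv : ∀ v, bottomPairing V M₃ v u = bottomPairing V M₃ v w) :
      u = w := (bottomEquivDual V M₃).injective (LinearMap.ext hv)
  have hact (x : chiralLE V) (v : BottomDual V M₃) (t : M₁ ⊗[ℂ] M₂) :
      ψ (restrictedAction V M₃ M₁ M₂ x (v ⊗ₜ t)) =
        bottomPairing V M₃ (rhoBottomDual V M₃ x v) (F t) +
          bottomPairing V M₃ v (F (rhoOneZero V M₁ M₂ x t)) := by
    simp [restrictedAction, h]
  constructor
  · intro hψ
    have hψ' (x : chiralLE V) (v : BottomDual V M₃) (t : M₁ ⊗[ℂ] M₂) :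
        bottomPairing V M₃ (rhoBottomDual V M₃ x v) (F t) +
          bottomPairing V M₃ v (F (rhoOneZero V M₁ M₂ x t)) = 0 := by
      rw [← hact]
      exact hψ (Submodule.subset_span ⟨x, _, rfl⟩)
    constructor
    · refine Submodule.span_le.2 ?_
      rintro _ ⟨x, hx, t, rfl⟩
      refine LinearMap.mem_ker.2 (hsep fun v => ?_)
      have := hψ' x v t
      rwa [rhoBottomDual_eq_zero V M₃ x hx, LinearMap.zero_apply, map_zero, LinearMap.zero_apply,
        zero_add, ← map_zero (bottomPairing V M₃ v)] at this
    · intro y t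
      refine hsep fun v => ?_
      have := hψ' (borcherdsZeroToChiral V y) v t
      rw [bottomPairing_rhoBottomDual] at this
      exact (neg_add_eq_zero.1 this).symm
  · rintro ⟨hF, hlie⟩
    refine Submodule.span_le.2 ?_
    rintro _ ⟨x, s, rfl⟩
    rw [SetLike.mem_coe, LinearMap.mem_ker]
    induction s using TensorProduct.induction_on with
    | zero => simp
    | add s s' hs hs' => rw [map_add, map_add, hs, hs', add_zero]
    | tmul v t =>
      obtain ⟨y, hy⟩ := exists_borcherdsZero_sub_mem V x
      obtain ⟨z, rfl⟩ : ∃ z, x = z + borcherdsZeroToChiral V y := ⟨_, (sub_add_cancel _ _).symm⟩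
      rw [add_sub_cancel_right] at hy
      have h1 : F (rhoOneZero V M₁ M₂ z t) = 0 := hF (Submodule.subset_span ⟨z, hy, t, rfl⟩)
      have h2 : rhoBottomDual V M₃ (z + borcherdsZeroToChiral V y) v =
          rhoBottomDual V M₃ z v + rhoBottomDual V M₃ (borcherdsZeroToChiral V y) v := by
        apply Subtype.ext
        change rhoInfty V M₃ ((z : ChiralLie V) + (borcherdsZeroToChiral V y : ChiralLie V)) v.1 = _
        rw [map_add]
        rfl
      have h3 : rhoOneZero V M₁ M₂ (z + borcherdsZeroToChiral V y : chiralLE V) =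
          rhoOneZero V M₁ M₂ z + rhoOneZero V M₁ M₂ (borcherdsZeroToChiral V y) :=
        map_add _ (z : ChiralLie V) (borcherdsZeroToChiral V y : ChiralLie V)
      rw [hact, h2, h3, rhoBottomDual_eq_zero V M₃ z hy, LinearMap.zero_apply, zero_add,
        LinearMap.add_apply, map_add, h1, hlie, zero_add,
        bottomPairing_rhoBottomDual, neg_add_cancel]

variable (V M₁ M₂ M₃)

/-- For a finite-dimensional bottom level `M(0)`, the functionals on `M(0)* ⊗ T` are the linear maps
from `T` to `M(0)`. -/
noncomputable def dualTensorEquivHom (M T : Type*) [AddCommGroup M] [Module ℂ M]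
    [AdmissibleModule V M] [FiniteDimensional ℂ (Bottom V M)] [AddCommGroup T] [Module ℂ T] :
    Module.Dual ℂ (BottomDual V M ⊗[ℂ] T) ≃ₗ[ℂ] (T →ₗ[ℂ] Bottom V M) :=
  (TensorProduct.lift.equiv (RingHom.id ℂ) (BottomDual V M) T ℂ).symm ≪≫ₗ LinearMap.lflip ≪≫ₗ
    LinearEquiv.congrRight (bottomEquivDual V M).symm

theorem bottomPairing_dualTensorEquivHom (M T : Type*) [AddCommGroup M] [Module ℂ M]
    [AdmissibleModule V M] [FiniteDimensional ℂ (Bottom V M)] [AddCommGroup T] [Module ℂ T]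
    (ψ : Module.Dual ℂ (BottomDual V M ⊗[ℂ] T)) (v : BottomDual V M) (t : T) :
    bottomPairing V M v (dualTensorEquivHom V M T ψ t) = ψ (v ⊗ₜ t) := by
  rw [← bottomEquivDual_apply]
  exact LinearMap.congr_fun ((bottomEquivDual V M).apply_symm_apply _) v

/-- The map `M₁ ⊗ M₂ → M₃(0)` of a restricted conformal block descends to `M₁ ⊙ M₂` and is
equivariant there. -/
theorem dualTensorEquivHom_mkQ [FiniteDimensional ℂ (Bottom V M₃)]
    (φ : RestrictedBlocks V M₃ M₁ M₂) :
    odotKernel V M₁ M₂ ≤ LinearMap.ker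
        (dualTensorEquivHom V M₃ _ (φ ∘ₗ (restrictedImage V M₃ M₁ M₂).mkQ)) ∧
      ∀ (y : borcherdsZero V) (t : M₁ ⊗[ℂ] M₂),
        dualTensorEquivHom V M₃ _ (φ ∘ₗ (restrictedImage V M₃ M₁ M₂).mkQ)
            (rhoOneZero V M₁ M₂ (borcherdsZeroToChiral V y) t) =
          ⁅y, dualTensorEquivHom V M₃ _ (φ ∘ₗ (restrictedImage V M₃ M₁ M₂).mkQ) t⁆ := by
  refine (restrictedImage_le_ker_iff _ _
    fun v t => (bottomPairing_dualTensorEquivHom V _ _ _ v t).symm).1 ?_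
  intro s hs
  rw [LinearMap.mem_ker, LinearMap.comp_apply, Submodule.mkQ_apply,
    (Submodule.Quotient.mk_eq_zero _).2 hs, map_zero]

/-- The homomorphism of `L(V)_0`-modules `M₁ ⊙ M₂ → M₃(0)` defined by a restricted conformal
block. -/
noncomputable def blockToHom [FiniteDimensional ℂ (Bottom V M₃)] :
    RestrictedBlocks V M₃ M₁ M₂ →ₗ[ℂ] (Odot V M₁ M₂ →ₗ⁅ℂ, borcherdsZero V⁆ Bottom V M₃) where
  toFun φ :=
    { (odotKernel V M₁ M₂).liftQ _ (dualTensorEquivHom_mkQ V M₁ M₂ M₃ φ).1 with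
      map_lie' := fun {y t} => by
        obtain ⟨t, rfl⟩ := Odot.mk_surjective V M₁ M₂ t
        exact (dualTensorEquivHom_mkQ V M₁ M₂ M₃ φ).2 y t }
  map_add' φ φ' := by
    ext t
    obtain ⟨t, rfl⟩ := Odot.mk_surjective V M₁ M₂ t
    change dualTensorEquivHom V M₃ _ _ t = dualTensorEquivHom V M₃ _ _ t +
      dualTensorEquivHom V M₃ _ _ t
    rw [LinearMap.add_comp, map_add, LinearMap.add_apply]
  map_smul' c φ := by
    ext t
    obtain ⟨t, rfl⟩ := Odot.mk_surjective V M₁ M₂ t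
    change dualTensorEquivHom V M₃ _ _ t = c • dualTensorEquivHom V M₃ _ _ t
    rw [LinearMap.smul_comp, map_smul, LinearMap.smul_apply]

theorem blockToHom_mk [FiniteDimensional ℂ (Bottom V M₃)] (φ : RestrictedBlocks V M₃ M₁ M₂)
    (t : M₁ ⊗[ℂ] M₂) : blockToHom V M₁ M₂ M₃ φ (Odot.mk V M₁ M₂ t) =
      dualTensorEquivHom V M₃ _ (φ ∘ₗ (restrictedImage V M₃ M₁ M₂).mkQ) t := rfl

theorem blockToHom_bijective [FiniteDimensional ℂ (Bottom V M₃)] :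
    Function.Bijective (blockToHom V M₁ M₂ M₃) := by
  constructor
  · intro φ φ' h
    apply Submodule.linearMap_qext
    apply (dualTensorEquivHom V M₃ (M₁ ⊗[ℂ] M₂)).injective
    refine LinearMap.ext fun t => ?_
    rw [← blockToHom_mk, ← blockToHom_mk, h]
  · intro g
    obtain ⟨ψ, hψ⟩ := (dualTensorEquivHom V M₃ (M₁ ⊗[ℂ] M₂)).surjective
      ((g : Odot V M₁ M₂ →ₗ[ℂ] Bottom V M₃) ∘ₗ Odot.mk V M₁ M₂)
    have hker : restrictedImage V M₃ M₁ M₂ ≤ LinearMap.ker ψ := by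
      refine (restrictedImage_le_ker_iff ψ _ fun v t =>
        (bottomPairing_dualTensorEquivHom V _ _ ψ v t).symm).2 ?_
      rw [hψ]
      constructor
      · intro t ht
        have : Odot.mk V M₁ M₂ t = 0 := (Submodule.Quotient.mk_eq_zero _).2 ht
        rw [LinearMap.mem_ker, LinearMap.comp_apply, this, map_zero]
      · intro y t
        exact g.map_lie y (Odot.mk V M₁ M₂ t)
    refine ⟨(restrictedImage V M₃ M₁ M₂).liftQ ψ hker, ?_⟩
    ext t
    obtain ⟨t, rfl⟩ := Odot.mk_surjective V M₁ M₂ t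
    rw [blockToHom_mk, Submodule.liftQ_mkQ, hψ]
    rfl

end Blocks

end ConformalBlocks

/-- The map `a_[wt a - 1] ↦ [a ⊗ z^(wt a - 1)]` is an isomorphism from the degree zero part `L(V)_0`
of the Borcherds Lie algebra to the quotient of the `∞`-restricted chiral Lie algebra by its
augmented ideal, and the `∞`-restricted conformal blocks for `(M₃(0)*, M₁, M₂)` are the
homomorphisms of `L(V)_0`-modules from `M₁ ⊙ M₂` to `M₃(0)`. -/
theorem mainTheorem4 (V M₁ M₂ M₃ : Type*) [AddCommGroup V] [Module ℂ V] [VertexOperatorAlgebra V]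
    [AddCommGroup M₁] [Module ℂ M₁] [AdmissibleModule V M₁]
    [AddCommGroup M₂] [Module ℂ M₂] [AdmissibleModule V M₂]
    [AddCommGroup M₃] [Module ℂ M₃] [AdmissibleModule V M₃] (h₃ : IsOrdinary V M₃) :
    Function.Bijective (borcherdsZeroToQuotient V) ∧
    ∃ Φ : RestrictedBlocks V M₃ M₁ M₂ ≃ₗ[ℂ] (Odot V M₁ M₂ →ₗ⁅ℂ, borcherdsZero V⁆ Bottom V M₃),
      ∀ (φ : RestrictedBlocks V M₃ M₁ M₂) (v : BottomDual V M₃) (v₁ : M₁) (v₂ : M₂),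
        bottomPairing V M₃ v (Φ φ (Odot.mk V M₁ M₂ (v₁ ⊗ₜ v₂))) =
          φ (Submodule.Quotient.mk (v ⊗ₜ (v₁ ⊗ₜ v₂))) := by
  refine ⟨borcherdsZeroToQuotient_bijective V, ?_⟩
  have : FiniteDimensional ℂ (Bottom V M₃) := h₃.finiteDimensional 0
  refine ⟨LinearEquiv.ofBijective _ (blockToHom_bijective V M₁ M₂ M₃), fun φ v v₁ v₂ => ?_⟩
  rw [LinearEquiv.ofBijective_apply, blockToHom_mk, bottomPairing_dualTensorEquivHom]
  rfl
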